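/- Let $\mathcal H,\mathcal K$ be finite-dimensional complex Hilbert spaces, let $\Phi:\mathcal B(\mathcal H)\to\mathcal B(\mathcal K)$ be a quantum channel (a completely positive trace-preserving linear map), and let $\rho$ be an invertible density operator on $\mathcal H$. Write $\Phi^\dagger$ for the adjoint of $\Phi$ with respect to the Hilbert–Schmidt inner product $\langle A,B\rangle=\operatorname{tr}(A^*B)$ and $\|X\|_1=\operatorname{tr}\,(X^*X)^{1/2}$ for the trace norm. Powers of $\Phi(\rho)$ are taken on its support (and are $0$ on its kernel). For $\alpha\in(0,\tfrac12)$ let $$\gamma^{(\alpha)}_\rho(A)=\operatorname{tr}\big(A^*\rho^{\alpha-1}A\rho^{-\alpha}\big),\qquad \gamma^{(\alpha)}_{\Phi(\rho)}(B)=\operatorname{tr}\big(B^*\Phi(\rho)^{\alpha-1}B\,\Phi(\rho)^{-\alpha}\big),$$ and for $t\in\mathbb R$ let $$\mathcal R^t_{\rho,\Phi}(B)=\rho^{\frac12-it}\,\Phi^\dagger\!\big(\Phi(\rho)^{-\frac12+it}\,B\,\Phi(\rho)^{-\frac12-it}\big)\,\rho^{\frac12+it}$$ be the rotated Petz map. Then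 for all $\alpha\in(0,\frac12)$, $t\in\mathbb R$ and $A\in\mathcal B(\mathcal H)$, $$\gamma^{(\alpha)}_\rho(A)-\gamma^{(\alpha)}_{\Phi(\rho)}(\Phi(A))\ \ge\ \left(\frac{\pi}{\cosh(\pi t)}\,\frac{\|A-\mathcal R^t_{\rho,\Phi}(\Phi(A))\|_1}{K}\right)^{2/\alpha},$$ where $$K=4\operatorname{tr}(A^*\rho^{-1}A)^{1/2}+2\operatorname{tr}(\rho^{-2}A^*\rho A)^{1/2}+2\operatorname{tr}\big(\Phi(\rho)^{-2}\Phi(A)^*\Phi(\rho)\Phi(A)\big)^{1/2}+\sqrt{\frac{\pi}{\alpha\sin(\pi\alpha)}}.$$ -/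

import Mathlib

open scoped ComplexOrder

noncomputable section

namespace AlphaMetric

variable {n m : Type*} [Fintype n] [DecidableEq n] [Fintype m] [DecidableEq m]

/-- The ampliation `id_k ⊗ Φ`, acting on `k × k` block matrices by applying `Φ` to each block. -/
def ampliation (k : ℕ) (Φ : Matrix n n ℂ →ₗ[ℂ] Matrix m m ℂ)
    (X : Matrix (Fin k × n) (Fin k × n) ℂ) : Matrix (Fin k × m) (Fin k × m) ℂ :=
  Matrix.of fun p q => Φ (Matrix.of fun a b => X (p.1, a) (q.1, b)) p.2 q.2

/-- A quantum channel: a completely positive trace preserving linear map. The operators on a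
finite-dimensional Hilbert space are written as matrices in an orthonormal basis. -/
structure IsQuantumChannel (Φ : Matrix n n ℂ →ₗ[ℂ] Matrix m m ℂ) : Prop where
  completelyPositive : ∀ (k : ℕ) (X : Matrix (Fin k × n) (Fin k × n) ℂ),
    X.PosSemidef → (ampliation k Φ X).PosSemidef
  tracePreserving : ∀ X : Matrix n n ℂ, (Φ X).trace = X.trace

/-- A faithful state: an invertible density operator. -/
structure IsFaithfulState (ρ : Matrix n n ℂ) : Prop where
  posDef : ρ.PosDef
  trace_eq_one : ρ.trace = 1

/-- The complex power `X ^ z` of a positive semidefinite matrix, by the spectral decomposition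
`X = U diag(λ) Uᴴ`. It is taken on the support of `X` and is `0` on the kernel, so that negative
powers of a singular matrix are powers of its generalized inverse.
(Matrices that are not Hermitian get the value `0`, which is never used.) -/
def mpow (X : Matrix n n ℂ) (z : ℂ) : Matrix n n ℂ :=
  open Classical in
  if hX : X.IsHermitian then
    (hX.eigenvectorUnitary : Matrix n n ℂ) *
      Matrix.diagonal (fun i => if hX.eigenvalues i = 0 then 0 else (hX.eigenvalues i : ℂ) ^ z) *
      (hX.eigenvectorUnitary : Matrix n n ℂ).conjTranspose
  else 0

/-- The trace norm `‖X‖₁ = tr |X|`, with `|X| = (Xᴴ X) ^ (1/2)`. -/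
def traceNorm (X : Matrix n n ℂ) : ℝ :=
  (mpow (X.conjTranspose * X) (1 / 2)).trace.re

/-- The adjoint of `Φ` for the Hilbert–Schmidt inner products `⟨A, B⟩ = tr (Aᴴ B)`. -/
def hsAdjoint (Φ : Matrix n n ℂ →ₗ[ℂ] Matrix m m ℂ) : Matrix m m ℂ →ₗ[ℂ] Matrix n n ℂ where
  toFun B := Matrix.of fun i j => ((Φ (Matrix.single i j 1)).conjTranspose * B).trace
  map_add' B C := by
    ext i j
    simp [Matrix.mul_add]
  map_smul' c B := by
    ext i j
    simp

/-- The defining property of the Hilbert–Schmidt adjoint. -/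
theorem trace_hsAdjoint (Φ : Matrix n n ℂ →ₗ[ℂ] Matrix m m ℂ) (A : Matrix n n ℂ)
    (B : Matrix m m ℂ) :
    (A.conjTranspose * hsAdjoint Φ B).trace = ((Φ A).conjTranspose * B).trace := by
  conv_rhs => rw [Matrix.matrix_eq_sum_single A]
  have h : ∀ i j, Matrix.single i j (A i j) = A i j • Matrix.single i j (1 : ℂ) := by
    intro i j
    simp
  simp only [h, map_sum, map_smul, Matrix.conjTranspose_sum, Matrix.conjTranspose_smul,
    Matrix.sum_mul, Matrix.smul_mul, Matrix.trace_sum, Matrix.trace_smul]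
  rw [Finset.sum_comm]
  simp [Matrix.trace, Matrix.mul_apply, hsAdjoint]

/-- The rotated Petz map
`B ↦ ρ^(1/2 - it) Φ†(Φ(ρ)^(-1/2 + it) B Φ(ρ)^(-1/2 - it)) ρ^(1/2 + it)`. -/
def rotatedPetz (ρ : Matrix n n ℂ) (Φ : Matrix n n ℂ →ₗ[ℂ] Matrix m m ℂ) (t : ℝ)
    (B : Matrix m m ℂ) : Matrix n n ℂ :=
  mpow ρ (1 / 2 - t * Complex.I) *
    hsAdjoint Φ (mpow (Φ ρ) (-(1 / 2) + t * Complex.I) * B *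
      mpow (Φ ρ) (-(1 / 2) - t * Complex.I)) *
    mpow ρ (1 / 2 + t * Complex.I)

/-- The `α`-metric `γ_ρ(A) = tr (Aᴴ ρ^(α-1) A ρ^(-α))` (a nonnegative real number). -/
def gammaAlpha (α : ℝ) (ρ A : Matrix n n ℂ) : ℝ :=
  (A.conjTranspose * mpow ρ ((α : ℂ) - 1) * A * mpow ρ (-(α : ℂ))).trace.re

/-- The constant
`K = 4 tr(Aᴴ ρ⁻¹ A)^(1/2) + 2 tr(ρ⁻² Aᴴ ρ A)^(1/2) + 2 tr(Φ(ρ)⁻² Φ(A)ᴴ Φ(ρ) Φ(A))^(1/2)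
  + (π / (α sin(π α)))^(1/2)`; the traces are nonnegative real numbers. -/
def recoveryConst (α : ℝ) (ρ : Matrix n n ℂ) (Φ : Matrix n n ℂ →ₗ[ℂ] Matrix m m ℂ)
    (A : Matrix n n ℂ) : ℝ :=
  4 * √((A.conjTranspose * mpow ρ (-1) * A).trace.re) +
    2 * √((mpow ρ (-2) * A.conjTranspose * ρ * A).trace.re) +
    2 * √((mpow (Φ ρ) (-2) * (Φ A).conjTranspose * Φ ρ * Φ A).trace.re) +
    √(Real.pi / (α * Real.sin (Real.pi * α)))

end AlphaMetric

end

noncomputable section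

/-! Both the `α`-metric and the Petz recovery error are integrals over `x > 0` of solutions of
Sylvester equations. Let `X_x` solve `x ρ X + X ρ = A`, and let `Y_x` solve the same equation for `Φ
ρ` and `Φ A`. Then `∫ x^(-α) tr(Aᴴ X_x) dx` is `π / sin(πα)` times the metric of `A`. The Mellin
transform of `X_x` at `s = 1/2 - it` is `π / cosh(πt)` times `ρ^(-s) A ρ^(s-1)`, so after
sandwiching with powers of `ρ` the transform of `X_x - Φ†(Y_x)` becomes `A` minus its recovery
(`rotatedPetz_sub_eq`).

The link is `resolvent_remainder`: Kadison–Schwarz bounds `x tr((X_x - Φ†Y_x)ᴴ ρ (X_x - Φ†Y_x))` by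
the integrand of the metric loss. By duality the trace norm is a pairing with a contraction, and
Cauchy–Schwarz bounds this pairing by `G(x)` with `x G(x)² ≤ d(x)`, where `∫ x^(-α) d` is controlled
by the loss. It remains to bound `∫ x^(-1/2) G`: `integral_le_mul_rpow_of_mul_sq_le` cuts the
half-line at a power of the loss, uses a uniform bound on `G` near `0` and Cauchy–Schwarz beyond. -/

namespace AlphaMetric

open Matrix MeasureTheory Set

/-! ### Scalar Mellin integrals. -/

/-- The Mellin transform of `(1 + x)⁻¹` on the strip `0 < Re s < 1`. -/
theorem hasMellin_one_add_inv {s : ℂ} (h0 : 0 < s.re) (h1 : s.re < 1) :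
    HasMellin (fun x : ℝ => ((1 + x : ℝ) : ℂ)⁻¹) s (Real.pi / Complex.sin (Real.pi * s)) := by
  -- The substitution `u = x / (1 + x)` turns the integral into the Beta integral `B(s, 1 - s) =
  -- Γ(s) Γ(1 - s)`, evaluated by the reflection formula.
  set φ : ℝ → ℝ := fun x => x / (1 + x)
  have hd : ∀ x ∈ Ioi (0 : ℝ), HasDerivWithinAt φ (1 / (1 + x) ^ 2) (Ioi 0) x := by
    intro x hx
    have hx' : (1 + x : ℝ) ≠ 0 := by have := mem_Ioi.1 hx; positivity
    have := ((hasDerivAt_id x).div ((hasDerivAt_id x).const_add 1) hx').hasDerivWithinAt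
      (s := Ioi 0)
    refine this.congr_deriv ?_
    simp
  have hinj : InjOn φ (Ioi 0) := by
    intro x hx y hy hxy
    have := mem_Ioi.1 hx
    have := mem_Ioi.1 hy
    simp only [φ] at hxy
    rw [div_eq_div_iff (by positivity) (by positivity)] at hxy
    linarith
  have himg : φ '' Ioi 0 = Ioo 0 1 := by
    ext y
    constructor
    · rintro ⟨x, hx, rfl⟩
      have := mem_Ioi.1 hx
      refine ⟨by positivity, ?_⟩
      simp only [φ]
      rw [div_lt_one (by positivity)]
      linarith
    · rintro ⟨hy0, hy1⟩
      have : 0 < 1 - y := by linarith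
      refine ⟨y / (1 - y), by simp only [mem_Ioi]; positivity, ?_⟩
      simp only [φ]
      field_simp
      ring
  set g : ℝ → ℂ := fun x => (x : ℂ) ^ (s - 1) * (1 - (x : ℂ)) ^ ((1 - s) - 1)
  have hs1 : 0 < (1 - s).re := by simpa using h1
  have hgi : IntegrableOn g (Ioo 0 1) := by
    have := Complex.betaIntegral_convergent h0 hs1
    rwa [intervalIntegrable_iff_integrableOn_Ioo_of_le zero_le_one] at this
  have hgv : ∫ x in Ioo (0 : ℝ) 1, g x = Real.pi / Complex.sin (Real.pi * s) := by
    rw [← integral_Ioc_eq_integral_Ioo, ← intervalIntegral.integral_of_le zero_le_one,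
      ← Complex.Gamma_mul_Gamma_one_sub, Complex.Gamma_mul_Gamma_eq_betaIntegral h0 hs1]
    simp [Complex.betaIntegral, g]
  have hcongr : ∀ x ∈ Ioi (0 : ℝ), |1 / (1 + x) ^ 2| • g (φ x)
      = (x : ℂ) ^ (s - 1) • ((1 + x : ℝ) : ℂ)⁻¹ := by
    intro x hx
    have hx : 0 < x := hx
    have h1x : 0 < 1 + x := by positivity
    have h1c : ((1 + x : ℝ) : ℂ) ≠ 0 := by exact_mod_cast h1x.ne'
    have e1 : (1 - ((φ x : ℝ) : ℂ)) = (((1 + x)⁻¹ : ℝ) : ℂ) := by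
      have : 1 - φ x = (1 + x)⁻¹ := by simp only [φ]; field_simp; ring
      rw [← this]; push_cast; rfl
    have e2 : ((φ x : ℝ) : ℂ) = (x : ℂ) * (((1 + x)⁻¹ : ℝ) : ℂ) := by
      simp [φ, div_eq_mul_inv]
    simp only [g]
    rw [e1, e2, Complex.mul_cpow_ofReal_nonneg hx.le (by positivity), mul_assoc,
      ← Complex.cpow_add _ _ (by exact_mod_cast (inv_pos.2 h1x).ne'),
      abs_of_pos (by positivity), Complex.real_smul]
    have e3 : s - 1 + (1 - s - 1) = -1 := by ring
    rw [e3, Complex.cpow_neg_one, smul_eq_mul]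
    push_cast at h1c ⊢
    field_simp
  constructor
  · have := (integrableOn_image_iff_integrableOn_abs_deriv_smul measurableSet_Ioi hd hinj g).1
      (by rwa [himg])
    exact this.congr_fun hcongr measurableSet_Ioi
  · rw [mellin, ← setIntegral_congr_fun measurableSet_Ioi hcongr,
      ← integral_image_eq_integral_abs_deriv_smul measurableSet_Ioi hd hinj g, himg, hgv]

theorem hasMellin_inv_mul_add {s : ℂ} (h0 : 0 < s.re) (h1 : s.re < 1) {q r : ℝ}
    (hq : 0 < q) (hr : 0 < r) :
    HasMellin (fun x : ℝ => ((q * x + r : ℝ) : ℂ)⁻¹) s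
      (Real.pi / Complex.sin (Real.pi * s) * ((q : ℂ) ^ (-s) * (r : ℂ) ^ (s - 1))) := by
  have h := hasMellin_one_add_inv h0 h1
  have hqr : 0 < q / r := by positivity
  have hrc : (r : ℂ) ≠ 0 := by exact_mod_cast hr.ne'
  have e : (fun x : ℝ => ((q * x + r : ℝ) : ℂ)⁻¹)
      = fun x : ℝ => (r : ℂ)⁻¹ • (fun x : ℝ => ((1 + x : ℝ) : ℂ)⁻¹) (q / r * x) := by
    ext x
    simp only [smul_eq_mul]
    rw [← mul_inv]
    congr 1
    push_cast
    field_simp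
    ring
  rw [e]
  refine ⟨((MellinConvergent.comp_mul_left hqr).2 h.1).const_smul _, ?_⟩
  rw [mellin_const_smul, mellin_comp_mul_left (fun x : ℝ => ((1 + x : ℝ) : ℂ)⁻¹) _ hqr, h.2, smul_eq_mul, smul_eq_mul,
    Complex.ofReal_div, div_eq_mul_inv (q : ℂ), ← Complex.ofReal_inv,
    Complex.mul_cpow_ofReal_nonneg hq.le (by positivity), Complex.ofReal_inv,
    Complex.inv_cpow _ _ (by rw [Complex.arg_ofReal_of_nonneg hr.le]; exact Real.pi_pos.ne),
    Complex.cpow_neg (r : ℂ), inv_inv, Complex.cpow_sub _ _ hrc, Complex.cpow_one]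
  field_simp

/-- Real form of `hasMellin_inv_mul_add` for the weight `x ^ (-α)`. -/
theorem integral_rpow_mul_inv_mul_add {α : ℝ} (h0 : 0 < α) (h1 : α < 1) {q r : ℝ}
    (hq : 0 < q) (hr : 0 < r) :
    IntegrableOn (fun x : ℝ => x ^ (-α) * (q * x + r)⁻¹) (Ioi 0) ∧
      ∫ x in Ioi (0 : ℝ), x ^ (-α) * (q * x + r)⁻¹
        = Real.pi / Real.sin (Real.pi * α) * (q ^ (α - 1) * r ^ (-α)) := by
  obtain ⟨hi, hv⟩ := hasMellin_inv_mul_add (s := ((1 - α : ℝ) : ℂ)) (by simpa using h1)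
    (by simpa using h0) hq hr
  have hcongr : ∀ x ∈ Ioi (0 : ℝ), (x : ℂ) ^ (((1 - α : ℝ) : ℂ) - 1) • ((q * x + r : ℝ) : ℂ)⁻¹
      = ((x ^ (-α) * (q * x + r)⁻¹ : ℝ) : ℂ) := by
    intro x hx
    have : (((1 - α : ℝ) : ℂ) - 1) = ((-α : ℝ) : ℂ) := by push_cast; ring
    rw [this, ← Complex.ofReal_cpow (le_of_lt hx), smul_eq_mul]
    push_cast
    rfl
  have hi' : IntegrableOn (fun x : ℝ => ((x ^ (-α) * (q * x + r)⁻¹ : ℝ) : ℂ)) (Ioi 0) :=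
    IntegrableOn.congr_fun hi hcongr measurableSet_Ioi
  refine ⟨?_, ?_⟩
  · exact hi'.re
  · rw [mellin, setIntegral_congr_fun measurableSet_Ioi hcongr, integral_complex_ofReal] at hv
    apply Complex.ofReal_injective
    rw [hv]
    have e1 : -((1 - α : ℝ) : ℂ) = ((α - 1 : ℝ) : ℂ) := by push_cast; ring
    have e2 : (((1 - α : ℝ) : ℂ) - 1) = ((-α : ℝ) : ℂ) := by push_cast; ring
    have e3 : Real.sin (Real.pi * (1 - α)) = Real.sin (Real.pi * α) := by
      rw [mul_sub, mul_one, Real.sin_pi_sub]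
    rw [e1, e2, ← Complex.ofReal_cpow hq.le, ← Complex.ofReal_cpow hr.le, ← Complex.ofReal_mul,
      ← Complex.ofReal_mul, ← Complex.ofReal_sin, e3]
    push_cast
    rfl

/-! ### Interpolation of scalar integrals. -/

theorem setIntegral_Ioc_le_of_le_const {G : ℝ → ℝ} {c a : ℝ} (ha : 0 < a)
    (hG : IntegrableOn (fun x : ℝ => x ^ (-(1 / 2) : ℝ) * G x) (Ioi 0))
    (hc : ∀ x, 0 < x → G x ≤ c) :
    ∫ x in Ioc 0 a, x ^ (-(1 / 2) : ℝ) * G x ≤ 2 * c * a ^ (1 / 2 : ℝ) := by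
  have hi : IntegrableOn (fun x : ℝ => x ^ (-(1 / 2) : ℝ) * c) (Ioc 0 a) := by
    have := intervalIntegral.intervalIntegrable_rpow' (a := 0) (b := a)
      (show (-1 : ℝ) < -(1 / 2) by norm_num)
    rw [intervalIntegrable_iff_integrableOn_Ioc_of_le ha.le] at this
    exact this.mul_const c
  calc ∫ x in Ioc 0 a, x ^ (-(1 / 2) : ℝ) * G x
      ≤ ∫ x in Ioc 0 a, x ^ (-(1 / 2) : ℝ) * c := by
        refine setIntegral_mono_on (hG.mono_set Ioc_subset_Ioi_self) hi measurableSet_Ioc ?_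
        intro x hx
        exact mul_le_mul_of_nonneg_left (hc x hx.1) (Real.rpow_nonneg hx.1.le _)
    _ = 2 * c * a ^ (1 / 2 : ℝ) := by
        rw [integral_mul_const, ← intervalIntegral.integral_of_le ha.le,
          integral_rpow (Or.inl (by norm_num))]
        norm_num
        ring

theorem setIntegral_Ioi_one_le_of_le_div {G : ℝ → ℝ} {b : ℝ}
    (hG : IntegrableOn (fun x : ℝ => x ^ (-(1 / 2) : ℝ) * G x) (Ioi 0))
    (hb : ∀ x, 0 < x → G x ≤ b / x) :
    ∫ x in Ioi 1, x ^ (-(1 / 2) : ℝ) * G x ≤ 2 * b := by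
  have hi : IntegrableOn (fun x : ℝ => x ^ (-(3 / 2) : ℝ) * b) (Ioi 1) :=
    (integrableOn_Ioi_rpow_of_lt (by norm_num) one_pos).mul_const b
  calc ∫ x in Ioi 1, x ^ (-(1 / 2) : ℝ) * G x
      ≤ ∫ x in Ioi 1, x ^ (-(3 / 2) : ℝ) * b := by
        refine setIntegral_mono_on (hG.mono_set (Ioi_subset_Ioi zero_le_one)) hi
          measurableSet_Ioi ?_
        intro x hx
        have hx : 0 < x := one_pos.trans hx
        refine (mul_le_mul_of_nonneg_left (hb x hx) (Real.rpow_nonneg hx.le _)).trans_eq ?_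
        have : (-(3 / 2) : ℝ) = -(1 / 2) - 1 := by norm_num
        rw [this, Real.rpow_sub_one hx.ne']
        ring
    _ = 2 * b := by
        rw [integral_mul_const, integral_Ioi_rpow_of_lt (by norm_num) one_pos]
        norm_num

/-- Cauchy–Schwarz for `x^(-1/2) G = (x^((1-α)/2) G) · x^((α-2)/2)`, in the weighted
arithmetic–geometric form; the weight `s` is left free to be optimised. -/
theorem setIntegral_Ioi_le_of_mul_sq_le {G d : ℝ → ℝ} {α a s I : ℝ} (ha : 0 < a) (hs : 0 < s)
    (h1 : α < 1)
    (hG : IntegrableOn (fun x : ℝ => x ^ (-(1 / 2) : ℝ) * G x) (Ioi 0))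
    (hd : IntegrableOn (fun x : ℝ => x ^ (-α) * d x) (Ioi 0))
    (hI : ∫ x in Ioi 0, x ^ (-α) * d x ≤ I)
    (hGd : ∀ x, 0 < x → x * G x ^ 2 ≤ d x) :
    ∫ x in Ioi a, x ^ (-(1 / 2) : ℝ) * G x ≤
      s / 2 * I + 1 / (2 * s) * (a ^ (α - 1) / (1 - α)) := by
  have hi : IntegrableOn (fun x : ℝ => x ^ (α - 2)) (Ioi a) :=
    integrableOn_Ioi_rpow_of_lt (by linarith) ha
  have hda : IntegrableOn (fun x : ℝ => x ^ (-α) * d x) (Ioi a) :=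
    hd.mono_set (Ioi_subset_Ioi ha.le)
  have hmono : ∫ x in Ioi a, x ^ (-α) * d x ≤ ∫ x in Ioi 0, x ^ (-α) * d x := by
    refine setIntegral_mono_set hd ?_ (Ioi_subset_Ioi ha.le).eventuallyLE
    refine (ae_restrict_iff' measurableSet_Ioi).2 (Filter.Eventually.of_forall fun x hx => ?_)
    have hx : 0 < x := hx
    exact mul_nonneg (Real.rpow_nonneg hx.le _) (le_trans (by positivity) (hGd x hx))
  calc ∫ x in Ioi a, x ^ (-(1 / 2) : ℝ) * G x
      ≤ ∫ x in Ioi a, (s / 2 * (x ^ (-α) * d x) + 1 / (2 * s) * x ^ (α - 2)) := by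
        refine setIntegral_mono_on (hG.mono_set (Ioi_subset_Ioi ha.le))
          ((hda.const_mul _).add (hi.const_mul _)) measurableSet_Ioi ?_
        intro x hx
        have hx : 0 < x := ha.trans hx
        set u := x ^ ((1 - α) / 2) with hu
        set v := x ^ ((α - 2) / 2) with hv
        have huv : x ^ (-(1 / 2) : ℝ) = u * v := by
          rw [hu, hv, ← Real.rpow_add hx]; ring_nf
        have hu2 : x ^ (-α) * x = u ^ 2 := by
          rw [hu, ← Real.rpow_mul_natCast hx.le, ← Real.rpow_add_one hx.ne']; congr 1; push_cast; ring
        have hv2 : x ^ (α - 2) = v ^ 2 := by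
          rw [hv, ← Real.rpow_mul_natCast hx.le]; congr 1; push_cast; ring
        have h1 : u ^ 2 * G x ^ 2 ≤ x ^ (-α) * d x := by
          rw [← hu2, mul_assoc]
          exact mul_le_mul_of_nonneg_left (hGd x hx) (Real.rpow_nonneg hx.le _)
        have h2 : u * v * G x ≤ s / 2 * (u ^ 2 * G x ^ 2) + 1 / (2 * s) * v ^ 2 := by
          have : s / 2 * (u ^ 2 * G x ^ 2) + 1 / (2 * s) * v ^ 2 - u * v * G x
              = (s * (u * G x) - v) ^ 2 / (2 * s) := by field_simp; ring
          have h3 : 0 ≤ (s * (u * G x) - v) ^ 2 / (2 * s) := by positivity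
          linarith
        rw [huv, hv2]
        refine h2.trans ?_
        gcongr
    _ = s / 2 * (∫ x in Ioi a, x ^ (-α) * d x) + 1 / (2 * s) * (a ^ (α - 1) / (1 - α)) := by
        rw [integral_add (hda.const_mul _) (hi.const_mul _), integral_const_mul,
          integral_const_mul, integral_Ioi_rpow_of_lt (by linarith) ha]
        congr 2
        rw [show α - 2 + 1 = α - 1 by ring, neg_div, ← div_neg]
        congr 1
        ring
    _ ≤ _ := by gcongr; exact hmono.trans hI

/-- The interpolation estimate: a function with `G x ≤ c` and `G x ≤ b / x` whose square is
controlled by an integrable density. -/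
theorem integral_le_mul_rpow_of_mul_sq_le {G d : ℝ → ℝ} {α b c δ : ℝ} (h0 : 0 < α)
    (h1 : α < 1 / 2) (hb : 0 ≤ b) (hc : 0 ≤ c) (hδ : 0 < δ)
    (hG : IntegrableOn (fun x : ℝ => x ^ (-(1 / 2) : ℝ) * G x) (Ioi 0))
    (hd : IntegrableOn (fun x : ℝ => x ^ (-α) * d x) (Ioi 0))
    (hI : ∫ x in Ioi 0, x ^ (-α) * d x ≤ Real.pi / Real.sin (Real.pi * α) * δ)
    (hGd : ∀ x, 0 < x → x * G x ^ 2 ≤ d x)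
    (hGc : ∀ x, 0 < x → G x ≤ c) (hGb : ∀ x, 0 < x → G x ≤ b / x) :
    ∫ x in Ioi 0, x ^ (-(1 / 2) : ℝ) * G x ≤
      (2 * c + 2 * b + √(Real.pi / (α * Real.sin (Real.pi * α)))) * δ ^ (α / 2) := by
  have hsplit : ∀ a : ℝ, 0 < a → ∫ x in Ioi 0, x ^ (-(1 / 2) : ℝ) * G x =
      (∫ x in Ioc 0 a, x ^ (-(1 / 2) : ℝ) * G x) + ∫ x in Ioi a, x ^ (-(1 / 2) : ℝ) * G x := by
    intro a ha
    rw [← setIntegral_union (Ioc_disjoint_Ioi le_rfl) measurableSet_Ioi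
      (hG.mono_set Ioc_subset_Ioi_self) (hG.mono_set (Ioi_subset_Ioi ha.le)),
      Ioc_union_Ioi_eq_Ioi ha.le]
  have hsin : 0 < Real.sin (Real.pi * α) :=
    Real.sin_pos_of_pos_of_lt_pi (by positivity) (by nlinarith [Real.pi_pos])
  set M := Real.pi / Real.sin (Real.pi * α) with hM
  have hMpos : 0 < M := div_pos Real.pi_pos hsin
  have hMα : Real.pi / (α * Real.sin (Real.pi * α)) = M / α := by rw [hM]; field_simp
  rw [hMα]
  -- For `δ ≥ 1` a bound independent of `δ` suffices, and `G ≤ b / x` handles the tail; for `δ ≤ 1`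
  -- the cut is at `δ^α`, which makes the part near `0` equal to `2 c δ^(α/2)`.
  rcases le_total 1 δ with hδ1 | hδ1
  · have h := setIntegral_Ioc_le_of_le_const one_pos hG hGc
    have h' := setIntegral_Ioi_one_le_of_le_div hG hGb
    rw [Real.one_rpow, mul_one] at h
    rw [hsplit 1 one_pos]
    have hone : 1 ≤ δ ^ (α / 2) := Real.one_le_rpow hδ1 (by positivity)
    have hs := Real.sqrt_nonneg (M / α)
    nlinarith
  · set S := √(M / α) with hS
    have hSpos : 0 < S := Real.sqrt_pos.2 (by positivity)
    have hS2 : S ^ 2 = M / α := Real.sq_sqrt (by positivity)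
    have hM' : M = S ^ 2 * α := by rw [hS2]; field_simp
    have ha : 0 < δ ^ α := Real.rpow_pos_of_pos hδ _
    have hδ2 : 0 < δ ^ (α / 2 - 1) := Real.rpow_pos_of_pos hδ _
    have h := setIntegral_Ioc_le_of_le_const ha hG hGc
    -- This weight makes the first term exactly `S / 2 · δ^(α/2)`, half of the target.
    have h' := setIntegral_Ioi_le_of_mul_sq_le (s := δ ^ (α / 2 - 1) / (S * α)) ha
      (by positivity) (by linarith) hG hd hI hGd
    rw [hsplit _ ha]
    have e1 : (δ ^ α) ^ (1 / 2 : ℝ) = δ ^ (α / 2) := by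
      rw [← Real.rpow_mul hδ.le]; ring_nf
    have e2 : δ ^ (α / 2 - 1) / (S * α) / 2 * (M * δ) = S / 2 * δ ^ (α / 2) := by
      rw [hM', Real.rpow_sub_one hδ.ne']
      field_simp
    have e3 : 1 / (2 * (δ ^ (α / 2 - 1) / (S * α))) * ((δ ^ α) ^ (α - 1) / (1 - α))
        ≤ S / 2 * δ ^ (α / 2) := by
      have h1α : 0 < 1 - α := by linarith
      have e4 : (δ ^ α) ^ (α - 1) / δ ^ (α / 2 - 1) ≤ δ ^ (α / 2) := by
        rw [← Real.rpow_mul hδ.le, ← Real.rpow_sub hδ]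
        -- The comparison of exponents amounts to `(1 - α)² ≥ 0`; the base is at most `1`.
        exact Real.rpow_le_rpow_of_exponent_ge hδ hδ1 (by nlinarith [sq_nonneg (1 - α)])
      have e5 : α / (1 - α) ≤ 1 := by rw [div_le_one h1α]; linarith
      calc 1 / (2 * (δ ^ (α / 2 - 1) / (S * α))) * ((δ ^ α) ^ (α - 1) / (1 - α))
          = S / 2 * (α / (1 - α)) * ((δ ^ α) ^ (α - 1) / δ ^ (α / 2 - 1)) := by
            field_simp
        _ ≤ S / 2 * 1 * δ ^ (α / 2) := by gcongr
        _ = _ := by ring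
    rw [e1] at h
    rw [e2] at h'
    have : 0 ≤ 2 * b * δ ^ (α / 2) := by positivity
    linarith

/-! ### Hilbert–Schmidt inner product. -/

section Trace

variable {n m : Type*} [Fintype n] [Fintype m]

theorem trace_conjTranspose_mul_re (X Y : Matrix n m ℂ) :
    (Xᴴ * Y).trace.re = (Yᴴ * X).trace.re := by
  rw [← Complex.conj_re, starRingEnd_apply, ← trace_conjTranspose, conjTranspose_mul,
    conjTranspose_conjTranspose]

theorem _root_.Matrix.PosSemidef.trace_re_nonneg {X : Matrix n n ℂ} (hX : X.PosSemidef) :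
    0 ≤ X.trace.re :=
  (Complex.le_def.1 hX.trace_nonneg).1

/-- The Cauchy–Schwarz inequality for the Hilbert–Schmidt inner product. -/
theorem norm_trace_conjTranspose_mul_le (X Y : Matrix n m ℂ) :
    ‖(Xᴴ * Y).trace‖ ^ 2 ≤ (Xᴴ * X).trace.re * (Yᴴ * Y).trace.re := by
  have hs : ∀ Z : Matrix n m ℂ, (Zᴴ * Z).trace.re = ∑ p : m × n, ‖Z p.2 p.1‖ ^ 2 := by
    intro Z
    simp [Matrix.trace, Matrix.mul_apply, Fintype.sum_prod_type, ← Complex.normSq_eq_norm_sq,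
      Complex.normSq_apply]
  have h1 : ‖(Xᴴ * Y).trace‖ ≤ ∑ p : m × n, ‖X p.2 p.1‖ * ‖Y p.2 p.1‖ := by
    rw [Matrix.trace, Fintype.sum_prod_type]
    refine (norm_sum_le _ _).trans (Finset.sum_le_sum fun i _ => ?_)
    rw [Matrix.diag_apply, Matrix.mul_apply]
    refine (norm_sum_le _ _).trans_eq ?_
    simp
  rw [hs, hs]
  exact (pow_le_pow_left₀ (norm_nonneg _) h1 2).trans (Finset.sum_mul_sq_le_sq_mul_sq _ _ _)

end Trace

/-! ### Consequences of complete positivity. -/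

section Channel

variable {n m : Type*} [Fintype n] [Fintype m] {Φ : Matrix n n ℂ →ₗ[ℂ] Matrix m m ℂ}

/-- The block matrix `(a_iᴴ R a_j)` is `aᴴ R a` for the block row `a`, hence positive. All uses of
complete positivity pass through this family. -/
theorem IsQuantumChannel.ampliation_posSemidef (hΦ : IsQuantumChannel Φ) {R : Matrix n n ℂ}
    (hR : R.PosSemidef) {k : ℕ} (a : Fin k → Matrix n n ℂ) :
    (Matrix.of fun p q : Fin k × m => Φ ((a p.1)ᴴ * R * a q.1) p.2 q.2).PosSemidef := by
  have h := hΦ.completelyPositive k _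
    (hR.conjTranspose_mul_mul_same (Matrix.of fun i (p : Fin k × n) => a p.1 i p.2))
  convert h using 1
  ext p q
  simp only [ampliation, Matrix.of_apply]
  congr 2

theorem IsQuantumChannel.sum_posSemidef (hΦ : IsQuantumChannel Φ) {R : Matrix n n ℂ}
    (hR : R.PosSemidef) {k : ℕ} (a : Fin k → Matrix n n ℂ) (y : Fin k → Matrix m m ℂ) :
    (∑ i, ∑ j, (y i)ᴴ * Φ ((a i)ᴴ * R * a j) * y j).PosSemidef := by
  have h := (hΦ.ampliation_posSemidef hR a).conjTranspose_mul_mul_same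
    (Matrix.of fun (p : Fin k × m) j => y p.1 p.2 j)
  convert h using 1
  ext i j
  simp only [Matrix.sum_apply, Matrix.mul_apply, Fintype.sum_prod_type, Finset.sum_mul,
    Matrix.of_apply, Matrix.conjTranspose_apply]
  rw [Finset.sum_comm]
  refine Finset.sum_congr rfl fun b _ => ?_
  rw [Finset.sum_comm]

variable [DecidableEq n]

/-- `Φ X` and `Φ Xᴴ` are the off-diagonal blocks of a positive, hence Hermitian, matrix. -/
theorem IsQuantumChannel.map_conjTranspose (hΦ : IsQuantumChannel Φ) (X : Matrix n n ℂ) :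
    Φ Xᴴ = (Φ X)ᴴ := by
  have h := (hΦ.ampliation_posSemidef PosSemidef.one ![1, X]).isHermitian
  ext i j
  have := h.apply (1, i) (0, j)
  simpa using this.symm

theorem IsQuantumChannel.posSemidef_map [DecidableEq m] (hΦ : IsQuantumChannel Φ) {R : Matrix n n ℂ}
    (hR : R.PosSemidef) : (Φ R).PosSemidef := by
  simpa using hΦ.sum_posSemidef (k := 1) hR (fun _ => 1) fun _ => 1

/-- The Kadison–Schwarz inequality for `Φ†`, traced against a state on the left. -/
theorem IsQuantumChannel.trace_hsAdjoint_left_le [DecidableEq m] (hΦ : IsQuantumChannel Φ) {R : Matrix n n ℂ}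
    (hR : R.PosSemidef) (y : Matrix m m ℂ) :
    ((hsAdjoint Φ y)ᴴ * (R * hsAdjoint Φ y)).trace.re ≤ (yᴴ * (Φ R * y)).trace.re := by
  set Y := hsAdjoint Φ y with hY
  -- The trace of this positive sum is `tr yᴴ Φ(R) y` minus two cross terms plus `tr Φ(Yᴴ R Y)`. By
  -- adjointness and trace preservation the last three each have real part `± tr Yᴴ R Y`.
  have h := (hΦ.sum_posSemidef (k := 2) hR ![1, Y] ![y, -1]).trace_re_nonneg
  have h1 : ((Φ (R * Y))ᴴ * y).trace = (Yᴴ * (R * Y)).trace := by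
    rw [← trace_hsAdjoint, ← hY, conjTranspose_mul, hR.isHermitian.eq, Matrix.mul_assoc]
  have h2 : (Φ (Yᴴ * R) * y).trace.re = (Yᴴ * (R * Y)).trace.re := by
    rw [← h1, ← hΦ.map_conjTranspose, conjTranspose_mul, hR.isHermitian.eq]
  have h3 : (yᴴ * Φ (R * Y)).trace.re = (Yᴴ * (R * Y)).trace.re := by
    rw [trace_conjTranspose_mul_re, h1]
  have h4 : (Φ (Yᴴ * R * Y)).trace.re = (Yᴴ * (R * Y)).trace.re := by
    rw [hΦ.tracePreserving, Matrix.mul_assoc]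
  simp [Fin.sum_univ_two, h2, h3, Matrix.mul_assoc] at h
  rw [Matrix.mul_assoc] at h4
  linarith

/-- The Kadison–Schwarz inequality for `Φ†`, traced against a state on the right. -/
theorem IsQuantumChannel.trace_hsAdjoint_right_le [DecidableEq m] (hΦ : IsQuantumChannel Φ) {R : Matrix n n ℂ}
    (hR : R.PosSemidef) (y : Matrix m m ℂ) :
    ((hsAdjoint Φ y)ᴴ * (hsAdjoint Φ y * R)).trace.re ≤ (yᴴ * (y * Φ R)).trace.re := by
  set Y := hsAdjoint Φ y with hY
  have h := (hΦ.sum_posSemidef (k := 2) hR ![1, Yᴴ] ![yᴴ, -1]).trace_re_nonneg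
  have h1 : ((Φ (Y * R))ᴴ * y).trace.re = (Yᴴ * (Y * R)).trace.re := by
    rw [← trace_hsAdjoint, ← hY, trace_conjTranspose_mul_re]
  have h2 : (Φ (Y * R) * yᴴ).trace.re = (Yᴴ * (Y * R)).trace.re := by
    rw [trace_mul_comm, trace_conjTranspose_mul_re, h1]
  have h3 : (y * Φ (R * Yᴴ)).trace.re = (Yᴴ * (Y * R)).trace.re := by
    rw [← h1, trace_mul_comm, ← hΦ.map_conjTranspose, conjTranspose_mul, hR.isHermitian.eq]
  have h4 : (Φ (Y * (R * Yᴴ))).trace.re = (Yᴴ * (Y * R)).trace.re := by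
    rw [hΦ.tracePreserving, ← Matrix.mul_assoc, trace_mul_comm]
  have h5 : (y * (Φ R * yᴴ)).trace.re = (yᴴ * (y * Φ R)).trace.re := by
    rw [← Matrix.mul_assoc, trace_mul_comm]
  simp [Fin.sum_univ_two, h2, h3, h5, Matrix.mul_assoc] at h
  linarith

/-- The image of a channel lives on the support of the image of a positive definite matrix. -/
theorem IsQuantumChannel.map_mulVec_eq_zero (hΦ : IsQuantumChannel Φ) {R : Matrix n n ℂ}
    (hR : R.PosDef) {v : m → ℂ} (hv : Φ R *ᵥ v = 0) (X : Matrix n n ℂ) : Φ X *ᵥ v = 0 := by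
  have hRu : IsUnit R.det := (Matrix.isUnit_iff_isUnit_det _).1 hR.isUnit
  -- The choice `R⁻¹ Xᴴ` makes the lower left block `Φ X`. The vector `(v, 0)` is isotropic for a
  -- positive form, hence in its kernel, and the second block of that equation is the claim.
  have h := hΦ.ampliation_posSemidef hR.posSemidef ![1, R⁻¹ * Xᴴ]
  set w : Fin 2 × m → ℂ := fun p => ![v, 0] p.1 p.2
  have key : ∀ p : Fin 2 × m, ((Matrix.of fun p q : Fin 2 × m =>
      Φ ((![1, R⁻¹ * Xᴴ] p.1)ᴴ * R * ![1, R⁻¹ * Xᴴ] q.1) p.2 q.2) *ᵥ w) p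
      = (Φ ((![1, R⁻¹ * Xᴴ] p.1)ᴴ * R) *ᵥ v) p.2 := by
    intro p
    simp [mulVec, dotProduct, Fintype.sum_prod_type, w]
  have h0 : star w ⬝ᵥ ((Matrix.of fun p q : Fin 2 × m =>
      Φ ((![1, R⁻¹ * Xᴴ] p.1)ᴴ * R * ![1, R⁻¹ * Xᴴ] q.1) p.2 q.2) *ᵥ w) = 0 := by
    rw [dotProduct]
    refine Finset.sum_eq_zero fun p _ => ?_
    rw [key]
    obtain ⟨i, k⟩ := p
    fin_cases i
    · simp [hv]
    · simp [w]
  have h1 := (h.dotProduct_mulVec_zero_iff w).1 h0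
  ext i
  have h2 := congrFun h1 (1, i)
  rw [key] at h2
  have h3 : (R⁻¹)ᴴ * R = 1 := by
    rw [conjTranspose_nonsing_inv, hR.isHermitian.eq, Matrix.nonsing_inv_mul _ hRu]
  simpa [conjTranspose_mul, Matrix.mul_assoc, h3] using h2

/-- Monotonicity of the resolvent forms `A ↦ tr (Aᴴ (λ L_R + μ R_R)⁻¹ A)` under a channel, with a
remainder term. -/
theorem IsQuantumChannel.resolvent_remainder [DecidableEq m] (hΦ : IsQuantumChannel Φ) {R : Matrix n n ℂ}
    (hR : R.PosSemidef) {lam mu : ℝ} (hl : 0 ≤ lam) (hm : 0 ≤ mu) {A x : Matrix n n ℂ}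
    {y : Matrix m m ℂ} (hx : (lam : ℂ) • (R * x) + (mu : ℂ) • (x * R) = A)
    (hy : (lam : ℂ) • (Φ R * y) + (mu : ℂ) • (y * Φ R) = Φ A) :
    lam * ((x - hsAdjoint Φ y)ᴴ * (R * (x - hsAdjoint Φ y))).trace.re ≤
      (Aᴴ * x).trace.re - ((Φ A)ᴴ * y).trace.re := by
  set Y := hsAdjoint Φ y with hY
  -- With `E(Z) = lam tr Zᴴ R Z + mu tr Zᴴ Z R`, expand `E(x - Y)`. The equation for `x` gives `E(x)
  -- = tr Aᴴ x` and cross terms `tr (Φ A)ᴴ y`, and Kadison–Schwarz gives `E(Y) ≤ tr (Φ A)ᴴ y`. The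
  -- `mu` part of `E(x - Y)` is nonnegative and is dropped.
  have hl1 := mul_le_mul_of_nonneg_left (hΦ.trace_hsAdjoint_left_le hR y) hl
  have hr1 := mul_le_mul_of_nonneg_left (hΦ.trace_hsAdjoint_right_le hR y) hm
  have hz : 0 ≤ ((x - Y)ᴴ * ((x - Y) * R)).trace.re := by
    have := (hR.mul_mul_conjTranspose_same (x - Y)).trace_re_nonneg
    rwa [trace_mul_comm] at this
  have hz' := mul_nonneg hm hz
  have e1 : (Aᴴ * Y).trace = ((Φ A)ᴴ * y).trace := trace_hsAdjoint Φ A y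
  have e2 : (Yᴴ * A).trace.re = ((Φ A)ᴴ * y).trace.re := by
    rw [trace_conjTranspose_mul_re, e1]
  have e3 : (yᴴ * Φ A).trace.re = ((Φ A)ᴴ * y).trace.re := trace_conjTranspose_mul_re _ _
  have e4 : (xᴴ * A).trace.re = (Aᴴ * x).trace.re := trace_conjTranspose_mul_re _ _
  have e1' : (Aᴴ * Y).trace.re = ((Φ A)ᴴ * y).trace.re := by rw [e1]
  have e5 : (Aᴴ * Y).trace = lam * (xᴴ * (R * Y)).trace + mu * (xᴴ * (Y * R)).trace := by
    rw [← hx]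
    simp only [conjTranspose_add, conjTranspose_smul, conjTranspose_mul, hR.isHermitian.eq,
      Matrix.add_mul, Matrix.smul_mul, trace_add, trace_smul, smul_eq_mul, Matrix.mul_assoc,
      Complex.star_def, Complex.conj_ofReal]
    rw [trace_mul_comm R, Matrix.mul_assoc]
  have e5' := congrArg Complex.re e5
  have f1 : (xᴴ * A).trace.re = lam * (xᴴ * (R * x)).trace.re + mu * (xᴴ * (x * R)).trace.re := by
    rw [← hx]; simp [Matrix.mul_add]
  have f2 : (Yᴴ * A).trace.re = lam * (Yᴴ * (R * x)).trace.re + mu * (Yᴴ * (x * R)).trace.re := by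
    rw [← hx]; simp [Matrix.mul_add]
  have f3 : (yᴴ * Φ A).trace.re
      = lam * (yᴴ * (Φ R * y)).trace.re + mu * (yᴴ * (y * Φ R)).trace.re := by
    rw [← hy]; simp [Matrix.mul_add]
  have g1 : ((x - Y)ᴴ * (R * (x - Y))).trace.re = (xᴴ * (R * x)).trace.re
      - (xᴴ * (R * Y)).trace.re - (Yᴴ * (R * x)).trace.re + (Yᴴ * (R * Y)).trace.re := by
    simp [Matrix.mul_sub, Matrix.sub_mul]; ring
  have g2 : ((x - Y)ᴴ * ((x - Y) * R)).trace.re = (xᴴ * (x * R)).trace.re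
      - (xᴴ * (Y * R)).trace.re - (Yᴴ * (x * R)).trace.re + (Yᴴ * (Y * R)).trace.re := by
    simp [Matrix.mul_sub, Matrix.sub_mul]; ring
  rw [g2] at hz'
  rw [g1]
  simp only [Complex.add_re, Complex.re_ofReal_mul] at e5'
  linarith

end Channel

/-! ### Schur multipliers. -/

section Schur

variable {n : Type*} [Fintype n]

/-- The Schur multiplier with symbol `k` in the basis `U`, applied to `A`. -/
def schur (U A : Matrix n n ℂ) (k : n → n → ℂ) : Matrix n n ℂ :=
  U * Matrix.of (fun i j => (Uᴴ * A * U) i j * k i j) * Uᴴ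

/-- Symbols matter only at nonzero entries of `A`, which lets a singular `Φ ρ` be treated like an
invertible one. -/
theorem schur_congr {U A : Matrix n n ℂ} {k k' : n → n → ℂ}
    (h : ∀ i j, (Uᴴ * A * U) i j ≠ 0 → k i j = k' i j) : schur U A k = schur U A k' := by
  rw [schur, schur]
  congr 3
  ext i j
  by_cases h0 : (Uᴴ * A * U) i j = 0
  · rw [h0, zero_mul, zero_mul]
  · rw [h i j h0]

theorem schur_add (U A : Matrix n n ℂ) (k k' : n → n → ℂ) :
    schur U A k + schur U A k' = schur U A (fun i j => k i j + k' i j) := by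
  rw [schur, schur, schur, ← Matrix.add_mul, ← Matrix.mul_add]
  congr 3
  ext i j
  simp [mul_add]

theorem smul_schur (U A : Matrix n n ℂ) (c : ℂ) (k : n → n → ℂ) :
    c • schur U A k = schur U A (fun i j => c * k i j) := by
  rw [schur, schur, ← Matrix.smul_mul, ← Matrix.mul_smul]
  congr 3
  ext i j
  simp only [Matrix.smul_apply, Matrix.of_apply, smul_eq_mul]
  ring

end Schur

/-! ### Spectral calculus, trace norm and Sylvester solutions. -/

section Spectral

variable {n : Type*} [Fintype n] [DecidableEq n]

/-- The power `x ^ z`, extended by `0` at `x = 0`. -/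
def supportPow (x : ℝ) (z : ℂ) : ℂ := if x = 0 then 0 else (x : ℂ) ^ z

/-- `X = U diag(p) Uᴴ` with `U` unitary, and the powers of `X` are read off from `p`. -/
structure IsDiagonalization (X U : Matrix n n ℂ) (p : n → ℝ) : Prop where
  conjTranspose_mul : Uᴴ * U = 1
  mul_conjTranspose : U * Uᴴ = 1
  eq_diagonal : X = U * diagonal (fun i => (p i : ℂ)) * Uᴴ
  mpow_eq : ∀ z, mpow X z = U * diagonal (fun i => supportPow (p i) z) * Uᴴ

theorem _root_.Matrix.IsHermitian.isDiagonalization {X : Matrix n n ℂ} (hX : X.IsHermitian) :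
    IsDiagonalization X (hX.eigenvectorUnitary : Matrix n n ℂ) hX.eigenvalues where
  conjTranspose_mul := by
    rw [← star_eq_conjTranspose]; exact Unitary.coe_star_mul_self hX.eigenvectorUnitary
  mul_conjTranspose := by
    rw [← star_eq_conjTranspose]; exact Unitary.coe_mul_star_self hX.eigenvectorUnitary
  eq_diagonal := by
    have h := hX.spectral_theorem
    rw [Unitary.conjStarAlgAut_apply] at h
    rw [← star_eq_conjTranspose]
    exact h
  mpow_eq z := by
    rw [mpow, dif_pos hX]
    rfl

theorem schur_one {U : Matrix n n ℂ} (hU : U * Uᴴ = 1) (A : Matrix n n ℂ) :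
    schur U A (fun _ _ => 1) = A := by
  have : (Matrix.of fun i j => (Uᴴ * A * U) i j * (1 : ℂ)) = Uᴴ * A * U := by
    ext i j; simp
  rw [schur, this]
  calc U * (Uᴴ * A * U) * Uᴴ = (U * Uᴴ) * A * (U * Uᴴ) := by simp only [Matrix.mul_assoc]
    _ = A := by rw [hU, Matrix.one_mul, Matrix.mul_one]

theorem diagonal_mul_schur {U : Matrix n n ℂ} (hU : Uᴴ * U = 1) (A : Matrix n n ℂ) (f : n → ℂ)
    (k : n → n → ℂ) :
    (U * diagonal f * Uᴴ) * schur U A k = schur U A (fun i j => f i * k i j) := by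
  rw [schur, schur]
  set K := Matrix.of (fun i j => (Uᴴ * A * U) i j * k i j) with hK
  have : Matrix.of (fun i j => (Uᴴ * A * U) i j * (f i * k i j)) = diagonal f * K := by
    ext i j
    rw [Matrix.diagonal_mul, hK, Matrix.of_apply, Matrix.of_apply]
    ring
  rw [this]
  calc (U * diagonal f * Uᴴ) * (U * K * Uᴴ) = U * diagonal f * (Uᴴ * U) * K * Uᴴ := by
        simp only [Matrix.mul_assoc]
    _ = _ := by rw [hU, Matrix.mul_one]; simp only [Matrix.mul_assoc]

theorem schur_mul_diagonal {U : Matrix n n ℂ} (hU : Uᴴ * U = 1) (A : Matrix n n ℂ) (f : n → ℂ)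
    (k : n → n → ℂ) :
    schur U A k * (U * diagonal f * Uᴴ) = schur U A (fun i j => k i j * f j) := by
  rw [schur, schur]
  set K := Matrix.of (fun i j => (Uᴴ * A * U) i j * k i j) with hK
  have : Matrix.of (fun i j => (Uᴴ * A * U) i j * (k i j * f j)) = K * diagonal f := by
    ext i j
    rw [Matrix.mul_diagonal, hK, Matrix.of_apply, Matrix.of_apply]
    ring
  rw [this]
  calc (U * K * Uᴴ) * (U * diagonal f * Uᴴ) = U * K * (Uᴴ * U) * diagonal f * Uᴴ := by
        simp only [Matrix.mul_assoc]
    _ = _ := by rw [hU, Matrix.mul_one]; simp only [Matrix.mul_assoc]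

theorem trace_conjTranspose_schur_mul_schur {U : Matrix n n ℂ} (hU : Uᴴ * U = 1)
    (A : Matrix n n ℂ) (k k' : n → n → ℂ) :
    ((schur U A k)ᴴ * schur U A k').trace
      = ∑ i, ∑ j, ((Complex.normSq ((Uᴴ * A * U) i j) : ℝ) : ℂ) * (star (k i j) * k' i j) := by
  rw [schur, schur]
  set K := Matrix.of (fun i j => (Uᴴ * A * U) i j * k i j) with hK
  set K' := Matrix.of (fun i j => (Uᴴ * A * U) i j * k' i j) with hK'
  have : (U * K * Uᴴ)ᴴ * (U * K' * Uᴴ) = U * (Kᴴ * K' * Uᴴ) := by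
    calc (U * K * Uᴴ)ᴴ * (U * K' * Uᴴ) = U * Kᴴ * (Uᴴ * U) * K' * Uᴴ := by
          simp only [Matrix.conjTranspose_mul, conjTranspose_conjTranspose, Matrix.mul_assoc]
      _ = _ := by rw [hU, Matrix.mul_one]; simp only [Matrix.mul_assoc]
  rw [this, trace_mul_comm, Matrix.mul_assoc, hU, Matrix.mul_one, Matrix.trace,
    Finset.sum_comm]
  refine Finset.sum_congr rfl fun j _ => ?_
  rw [Matrix.diag_apply, Matrix.mul_apply]
  refine Finset.sum_congr rfl fun i _ => ?_
  rw [Matrix.conjTranspose_apply, hK, hK', Matrix.of_apply, Matrix.of_apply, star_mul',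
    Complex.normSq_eq_conj_mul_self, starRingEnd_apply]
  ring

theorem trace_conjTranspose_mul_schur {U : Matrix n n ℂ} (hU : Uᴴ * U = 1) (hU' : U * Uᴴ = 1)
    (A : Matrix n n ℂ) (k : n → n → ℂ) :
    (Aᴴ * schur U A k).trace
      = ∑ i, ∑ j, ((Complex.normSq ((Uᴴ * A * U) i j) : ℝ) : ℂ) * k i j := by
  have h := trace_conjTranspose_schur_mul_schur hU A (fun _ _ => 1) k
  rw [schur_one hU'] at h
  simpa using h

/-- Writes a functional of a Schur multiplier as a finite combination of symbol values, so Mellin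
transforms reduce to scalar ones. -/
theorem map_schur (L : Matrix n n ℂ →ₗ[ℂ] ℂ) (U A : Matrix n n ℂ) (k : n → n → ℂ) :
    L (schur U A k) = ∑ i, ∑ j, k i j * ((Uᴴ * A * U) i j * L (U * single i j 1 * Uᴴ)) := by
  rw [schur, matrix_eq_sum_single (Matrix.of fun i j => (Uᴴ * A * U) i j * k i j)]
  have h : ∀ (i j : n) (c : ℂ), single i j c = c • single i j (1 : ℂ) := by
    intro i j c; simp
  simp only [Matrix.mul_sum, Matrix.sum_mul, map_sum]
  refine Finset.sum_congr rfl fun i _ => Finset.sum_congr rfl fun j _ => ?_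
  rw [h, Matrix.mul_smul, Matrix.smul_mul, map_smul, Matrix.of_apply, smul_eq_mul]
  ring

theorem supportPow_add (x : ℝ) (z w : ℂ) :
    supportPow x z * supportPow x w = supportPow x (z + w) := by
  unfold supportPow
  split_ifs with h
  · simp
  · rw [Complex.cpow_add _ _ (by exact_mod_cast h)]

theorem supportPow_of_pos {x : ℝ} (hx : 0 < x) (z : ℂ) : supportPow x z = (x : ℂ) ^ z :=
  if_neg hx.ne'

theorem supportPow_ofReal {x : ℝ} (hx : 0 < x) (r : ℝ) :
    supportPow x r = ((x ^ r : ℝ) : ℂ) := by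
  rw [supportPow_of_pos hx, Complex.ofReal_cpow hx.le]

theorem star_supportPow {x : ℝ} (hx : 0 ≤ x) (z : ℂ) :
    star (supportPow x z) = supportPow x (star z) := by
  unfold supportPow
  split_ifs with h
  · simp
  · rw [Complex.star_def, Complex.cpow_conj _ _ ?_, Complex.conj_ofReal]
    rw [Complex.arg_ofReal_of_nonneg hx]
    exact Real.pi_pos.ne

namespace IsDiagonalization

variable {X U : Matrix n n ℂ} {p : n → ℝ}

theorem mpow_mul_mpow (h : IsDiagonalization X U p) (z w : ℂ) :
    mpow X z * mpow X w = mpow X (z + w) := by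
  rw [h.mpow_eq, h.mpow_eq, h.mpow_eq]
  simp only [← supportPow_add]
  rw [← diagonal_mul_diagonal]
  calc _ = U * diagonal (fun i => supportPow (p i) z) * (Uᴴ * U) *
        diagonal (fun i => supportPow (p i) w) * Uᴴ := by simp only [Matrix.mul_assoc]
    _ = _ := by rw [h.conjTranspose_mul, Matrix.mul_one]; simp only [Matrix.mul_assoc]

theorem mpow_zero (h : IsDiagonalization X U p) (hp : ∀ i, 0 < p i) : mpow X 0 = 1 := by
  rw [h.mpow_eq]
  simp only [supportPow_of_pos (hp _), Complex.cpow_zero]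
  rw [diagonal_one, Matrix.mul_one, h.mul_conjTranspose]

theorem mpow_one (h : IsDiagonalization X U p) : mpow X 1 = X := by
  rw [h.mpow_eq]
  conv_rhs => rw [h.eq_diagonal]
  congr 3
  ext i
  unfold supportPow
  split_ifs with h0 <;> simp [h0]

theorem conjTranspose_mpow (h : IsDiagonalization X U p) (hp : ∀ i, 0 ≤ p i) (z : ℂ) :
    (mpow X z)ᴴ = mpow X (star z) := by
  rw [h.mpow_eq, h.mpow_eq, Matrix.conjTranspose_mul, Matrix.conjTranspose_mul,
    conjTranspose_conjTranspose, diagonal_conjTranspose, Matrix.mul_assoc]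
  congr 4
  ext i
  exact star_supportPow (hp i) z

theorem mpow_mul_mul_mpow (h : IsDiagonalization X U p) (A : Matrix n n ℂ) (z w : ℂ) :
    mpow X z * A * mpow X w = schur U A fun i j => supportPow (p i) z * supportPow (p j) w := by
  conv_lhs => rw [← schur_one h.mul_conjTranspose A]
  rw [h.mpow_eq, h.mpow_eq, diagonal_mul_schur h.conjTranspose_mul,
    schur_mul_diagonal h.conjTranspose_mul]
  simp

end IsDiagonalization

/-- The trace norm is attained at a contraction. -/
theorem exists_traceNorm_eq (M : Matrix n n ℂ) :
    ∃ W : Matrix n n ℂ, (1 - Wᴴ * W).PosSemidef ∧ traceNorm M = (Wᴴ * M).trace.re := by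
  have hM := posSemidef_conjTranspose_mul_self M
  have h := hM.isHermitian.isDiagonalization
  have hp := hM.eigenvalues_nonneg
  set U := (hM.isHermitian.eigenvectorUnitary : Matrix n n ℂ)
  set p := hM.isHermitian.eigenvalues
  have hD : (mpow (Mᴴ * M) (-(1 / 2)))ᴴ = mpow (Mᴴ * M) (-(1 / 2)) := by
    rw [h.conjTranspose_mpow hp]; simp
  -- The partial isometry of the polar decomposition. `Wᴴ W` is the zeroth power of `Mᴴ M`, which is
  -- the support projection and not `1` when `M` is singular.
  refine ⟨M * mpow (Mᴴ * M) (-(1 / 2)), ?_, ?_⟩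
  · have e : (M * mpow (Mᴴ * M) (-(1 / 2)))ᴴ * (M * mpow (Mᴴ * M) (-(1 / 2)))
        = mpow (Mᴴ * M) 0 := by
      calc _ = mpow (Mᴴ * M) (-(1 / 2)) * (Mᴴ * M) * mpow (Mᴴ * M) (-(1 / 2)) := by
            rw [conjTranspose_mul, hD]; simp only [Matrix.mul_assoc]
        _ = mpow (Mᴴ * M) (-(1 / 2)) * mpow (Mᴴ * M) 1 * mpow (Mᴴ * M) (-(1 / 2)) := by
            rw [h.mpow_one]
        _ = _ := by rw [h.mpow_mul_mpow, h.mpow_mul_mpow]; norm_num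
    have e' : (1 : Matrix n n ℂ) - mpow (Mᴴ * M) 0
        = U * diagonal (fun i => 1 - supportPow (p i) 0) * Uᴴ := by
      rw [h.mpow_eq, ← h.mul_conjTranspose]
      have : diagonal (fun i => 1 - supportPow (p i) 0)
          = 1 - diagonal (fun i => supportPow (p i) 0) := by
        rw [← diagonal_one, diagonal_sub]
      rw [this, Matrix.mul_sub, Matrix.sub_mul, Matrix.mul_one]
    rw [e, e']
    refine PosSemidef.mul_mul_conjTranspose_same (PosSemidef.diagonal fun i => ?_) U
    simp only [supportPow, Complex.cpow_zero, Pi.zero_apply]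
    split_ifs <;> simp
  · rw [conjTranspose_mul, hD, Matrix.mul_assoc, traceNorm]
    congr 2
    calc _ = mpow (Mᴴ * M) (-(1 / 2)) * mpow (Mᴴ * M) 1 := by
          rw [h.mpow_mul_mpow]; norm_num
      _ = _ := by rw [h.mpow_one]

theorem traceNorm_nonneg (M : Matrix n n ℂ) : 0 ≤ traceNorm M := by
  have hM := posSemidef_conjTranspose_mul_self M
  have h := hM.isHermitian.isDiagonalization
  have e : mpow (Mᴴ * M) (1 / 2) = (mpow (Mᴴ * M) (1 / 4))ᴴ * mpow (Mᴴ * M) (1 / 4) := by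
    rw [h.conjTranspose_mpow hM.eigenvalues_nonneg, h.mpow_mul_mpow]
    congr 1
    simp
    norm_num
  rw [traceNorm, e]
  exact (posSemidef_conjTranspose_mul_self _).trace_re_nonneg

/-- All matrix entries of `A` in the basis `U` are supported where the weights are positive. -/
def IsSupportedOn (U : Matrix n n ℂ) (p : n → ℝ) (A : Matrix n n ℂ) : Prop :=
  ∀ i j, (Uᴴ * A * U) i j ≠ 0 → 0 < p i ∧ 0 < p j

/-- The solution `y` of `x X y + y X = A`, where `X = U diag(p) Uᴴ`. -/
def sylvester (U : Matrix n n ℂ) (p : n → ℝ) (A : Matrix n n ℂ) (x : ℝ) : Matrix n n ℂ :=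
  schur U A fun i j => ((p i * x + p j : ℝ) : ℂ)⁻¹

namespace IsDiagonalization

variable {X U : Matrix n n ℂ} {p : n → ℝ}

theorem sylvester_spec (h : IsDiagonalization X U p) {A : Matrix n n ℂ}
    (hA : IsSupportedOn U p A) {x : ℝ} (hx : 0 < x) :
    (x : ℂ) • (X * sylvester U p A x) + ((1 : ℝ) : ℂ) • (sylvester U p A x * X) = A := by
  rw [h.eq_diagonal, sylvester, diagonal_mul_schur h.conjTranspose_mul,
    schur_mul_diagonal h.conjTranspose_mul, smul_schur, smul_schur, schur_add]
  conv_rhs => rw [← schur_one h.mul_conjTranspose A]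
  refine schur_congr fun i j hij => ?_
  obtain ⟨hi, hj⟩ := hA i j hij
  have : ((p i * x + p j : ℝ) : ℂ) ≠ 0 := by
    have : 0 < p i * x + p j := by positivity
    exact_mod_cast this.ne'
  push_cast at this ⊢
  field_simp

theorem mul_mpow_neg_one_mul (h : IsDiagonalization X U p) {A : Matrix n n ℂ}
    (hA : IsSupportedOn U p A) : X * (mpow X (-1) * A) = A := by
  conv_rhs => rw [← schur_one h.mul_conjTranspose A]
  conv_lhs => rw [← schur_one h.mul_conjTranspose A]
  rw [h.mpow_eq, diagonal_mul_schur h.conjTranspose_mul]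
  conv_lhs => rw [h.eq_diagonal, diagonal_mul_schur h.conjTranspose_mul]
  refine schur_congr fun i j hij => ?_
  have hi := (hA i j hij).1
  have : (p i : ℂ) ≠ 0 := by exact_mod_cast hi.ne'
  rw [supportPow_of_pos hi, Complex.cpow_neg_one]
  field_simp

/-- In the eigenbasis the form has weights `p_i / (p_i x + p_j)²`. Dropping `p_i x` from the
denominator gives the first bound, dropping `p_j` the second. -/
theorem trace_sylvester_le (h : IsDiagonalization X U p) {A : Matrix n n ℂ}
    (hA : IsSupportedOn U p A) {x : ℝ} (hx : 0 < x) :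
    ((sylvester U p A x)ᴴ * (X * sylvester U p A x)).trace.re
        ≤ (mpow X (-2) * Aᴴ * X * A).trace.re ∧
      ((sylvester U p A x)ᴴ * (X * sylvester U p A x)).trace.re
        ≤ (Aᴴ * mpow X (-1) * A).trace.re / x ^ 2 := by
  have e1 : ((sylvester U p A x)ᴴ * (X * sylvester U p A x)).trace.re
      = ∑ i, ∑ j, Complex.normSq ((Uᴴ * A * U) i j) * (p i / (p i * x + p j) ^ 2) := by
    conv_lhs => rw [h.eq_diagonal, sylvester, diagonal_mul_schur h.conjTranspose_mul,
      trace_conjTranspose_schur_mul_schur h.conjTranspose_mul]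
    rw [← Complex.ofReal_re (∑ i, ∑ j, _)]
    push_cast
    congr 1
    refine Finset.sum_congr rfl fun i _ => Finset.sum_congr rfl fun j _ => ?_
    simp only [star_inv₀, star_add, star_mul', Complex.star_def, Complex.conj_ofReal]
    rw [div_eq_mul_inv, sq, mul_inv]
    ring
  have e2 : (mpow X (-2) * Aᴴ * X * A).trace
      = ∑ i, ∑ j, ((Complex.normSq ((Uᴴ * A * U) i j) : ℝ) : ℂ) *
        (supportPow (p i) 1 * supportPow (p j) (-2)) := by
    rw [← trace_conjTranspose_mul_schur h.conjTranspose_mul h.mul_conjTranspose,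
      ← h.mpow_mul_mul_mpow, h.mpow_one, Matrix.mul_assoc, Matrix.mul_assoc, trace_mul_comm]
    simp only [Matrix.mul_assoc]
  have e3 : (Aᴴ * mpow X (-1) * A).trace
      = ∑ i, ∑ j, ((Complex.normSq ((Uᴴ * A * U) i j) : ℝ) : ℂ) * (supportPow (p i) (-1)) := by
    have := trace_conjTranspose_mul_schur h.conjTranspose_mul h.mul_conjTranspose A
      (fun i _ => supportPow (p i) (-1) * 1)
    rw [← diagonal_mul_schur h.conjTranspose_mul, ← h.mpow_eq,
      schur_one h.mul_conjTranspose] at this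
    simpa [Matrix.mul_assoc] using this
  rw [e1, e2, e3, Complex.re_sum, Complex.re_sum, Finset.sum_div]
  simp only [Complex.re_sum, Finset.sum_div, Complex.re_ofReal_mul]
  constructor
  · refine Finset.sum_le_sum fun i _ => Finset.sum_le_sum fun j _ => ?_
    by_cases h0 : (Uᴴ * A * U) i j = 0
    · simp [h0]
    obtain ⟨hi, hj⟩ := hA i j h0
    refine mul_le_mul_of_nonneg_left ?_ (Complex.normSq_nonneg _)
    have : supportPow (p i) 1 * supportPow (p j) (-2) = ((p i / p j ^ 2 : ℝ) : ℂ) := by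
      rw [supportPow_of_pos hi, supportPow_of_pos hj, Complex.cpow_one, Complex.cpow_neg,
        Complex.cpow_ofNat]
      push_cast
      rw [div_eq_mul_inv]
    rw [this, Complex.ofReal_re]
    gcongr
    have := mul_pos hi hx
    linarith
  · refine Finset.sum_le_sum fun i _ => Finset.sum_le_sum fun j _ => ?_
    by_cases h0 : (Uᴴ * A * U) i j = 0
    · simp [h0]
    obtain ⟨hi, hj⟩ := hA i j h0
    rw [mul_div_assoc]
    refine mul_le_mul_of_nonneg_left ?_ (Complex.normSq_nonneg _)
    rw [supportPow_of_pos hi, Complex.cpow_neg_one, ← Complex.ofReal_inv, Complex.ofReal_re]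
    calc p i / (p i * x + p j) ^ 2 ≤ p i / (p i * x) ^ 2 := by gcongr; linarith
      _ = (p i)⁻¹ / x ^ 2 := by field_simp

theorem hasMellin_sylvester (h : IsDiagonalization X U p) {A : Matrix n n ℂ}
    (hA : IsSupportedOn U p A) (L : Matrix n n ℂ →ₗ[ℂ] ℂ) {s : ℂ} (h0 : 0 < s.re)
    (h1 : s.re < 1) :
    HasMellin (fun x => L (sylvester U p A x)) s
      (Real.pi / Complex.sin (Real.pi * s) * L (mpow X (-s) * A * mpow X (s - 1))) := by
  have hterm : ∀ i j, HasMellin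
      (fun x : ℝ => ((p i * x + p j : ℝ) : ℂ)⁻¹ *
        ((Uᴴ * A * U) i j * L (U * single i j 1 * Uᴴ))) s
      (Real.pi / Complex.sin (Real.pi * s) *
        (supportPow (p i) (-s) * supportPow (p j) (s - 1) *
          ((Uᴴ * A * U) i j * L (U * single i j 1 * Uᴴ)))) := by
    intro i j
    by_cases hij : (Uᴴ * A * U) i j = 0
    · simp only [hij, zero_mul, mul_zero]
      refine ⟨?_, by simp [mellin]⟩
      simp [MellinConvergent]
    obtain ⟨hi, hj⟩ := hA i j hij
    have := hasMellin_inv_mul_add h0 h1 hi hj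
    have := hasMellin_const_smul this.1 ((Uᴴ * A * U) i j * L (U * single i j 1 * Uᴴ))
    rw [(hasMellin_inv_mul_add h0 h1 hi hj).2] at this
    rw [supportPow_of_pos hi, supportPow_of_pos hj]
    convert this using 1
    · ext x
      rw [smul_eq_mul, mul_comm]
    · rw [smul_eq_mul]
      ring
  rw [h.mpow_mul_mul_mpow, map_schur]
  simp only [sylvester, map_schur, Finset.mul_sum]
  have hint : ∀ i j, IntegrableOn (fun x : ℝ => (x : ℂ) ^ (s - 1) •
      (((p i * x + p j : ℝ) : ℂ)⁻¹ * ((Uᴴ * A * U) i j * L (U * single i j 1 * Uᴴ)))) (Ioi 0) :=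
    fun i j => (hterm i j).1
  constructor
  · simp only [MellinConvergent, Finset.smul_sum]
    exact integrable_finsetSum _ fun i _ => integrable_finsetSum _ fun j _ => hint i j
  · simp only [mellin, Finset.smul_sum]
    rw [integral_finsetSum _ fun i _ => integrable_finsetSum _ fun j _ => hint i j]
    refine Finset.sum_congr rfl fun i _ => ?_
    rw [integral_finsetSum _ fun j _ => hint i j]
    exact Finset.sum_congr rfl fun j _ => (hterm i j).2

theorem integral_trace_sylvester (h : IsDiagonalization X U p) {A : Matrix n n ℂ}
    (hA : IsSupportedOn U p A) {α : ℝ} (h0 : 0 < α) (h1 : α < 1) :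
    IntegrableOn (fun x : ℝ => x ^ (-α) * (Aᴴ * sylvester U p A x).trace.re) (Ioi 0) ∧
      ∫ x in Ioi (0 : ℝ), x ^ (-α) * (Aᴴ * sylvester U p A x).trace.re
        = Real.pi / Real.sin (Real.pi * α) * gammaAlpha α X A := by
  have hterm : ∀ i j, IntegrableOn (fun x : ℝ => Complex.normSq ((Uᴴ * A * U) i j) *
        (x ^ (-α) * (p i * x + p j)⁻¹)) (Ioi 0) ∧
      ∫ x in Ioi (0 : ℝ), Complex.normSq ((Uᴴ * A * U) i j) * (x ^ (-α) * (p i * x + p j)⁻¹)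
        = Real.pi / Real.sin (Real.pi * α) * (Complex.normSq ((Uᴴ * A * U) i j) *
          (supportPow (p i) ((α : ℂ) - 1) * supportPow (p j) (-(α : ℂ))).re) := by
    intro i j
    by_cases hij : (Uᴴ * A * U) i j = 0
    · simp [hij]
    obtain ⟨hi, hj⟩ := hA i j hij
    obtain ⟨k1, k2⟩ := integral_rpow_mul_inv_mul_add h0 h1 hi hj
    refine ⟨k1.const_mul _, ?_⟩
    have e1 : ((α : ℂ) - 1) = ((α - 1 : ℝ) : ℂ) := by push_cast; rfl
    have e2 : (-(α : ℂ)) = ((-α : ℝ) : ℂ) := by push_cast; rfl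
    rw [integral_const_mul, k2, e1, e2, supportPow_ofReal hi, supportPow_ofReal hj,
      ← Complex.ofReal_mul, Complex.ofReal_re]
    ring
  have e1 : ∀ x : ℝ, x ^ (-α) * (Aᴴ * sylvester U p A x).trace.re
      = ∑ i, ∑ j, Complex.normSq ((Uᴴ * A * U) i j) * (x ^ (-α) * (p i * x + p j)⁻¹) := by
    intro x
    rw [sylvester, trace_conjTranspose_mul_schur h.conjTranspose_mul h.mul_conjTranspose]
    simp only [Complex.re_sum, Complex.re_ofReal_mul, ← Complex.ofReal_inv, Complex.ofReal_re,
      Finset.mul_sum]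
    refine Finset.sum_congr rfl fun i _ => Finset.sum_congr rfl fun j _ => by ring
  have e2 : gammaAlpha α X A = ∑ i, ∑ j, Complex.normSq ((Uᴴ * A * U) i j) *
      (supportPow (p i) ((α : ℂ) - 1) * supportPow (p j) (-(α : ℂ))).re := by
    rw [gammaAlpha, Matrix.mul_assoc, Matrix.mul_assoc, ← Matrix.mul_assoc (mpow X _),
      h.mpow_mul_mul_mpow,
      trace_conjTranspose_mul_schur h.conjTranspose_mul h.mul_conjTranspose]
    simp only [Complex.re_sum, Complex.re_ofReal_mul]
  rw [e2]
  simp only [e1, Finset.mul_sum]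
  refine ⟨integrable_finsetSum _ fun i _ => integrable_finsetSum _ fun j _ => (hterm i j).1, ?_⟩
  rw [integral_finsetSum _ fun i _ => integrable_finsetSum _ fun j _ => (hterm i j).1]
  refine Finset.sum_congr rfl fun i _ => ?_
  rw [integral_finsetSum _ fun j _ => (hterm i j).1]
  exact Finset.sum_congr rfl fun j _ => (hterm i j).2

end IsDiagonalization

end Spectral

/-! ### Recovery bound for the rotated Petz map. -/

section Recovery

variable {n m : Type*} [Fintype n] [Fintype m]

theorem isSupportedOn_of_pos {U : Matrix n n ℂ} {p : n → ℝ} (hp : ∀ i, 0 < p i)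
    (A : Matrix n n ℂ) : IsSupportedOn U p A :=
  fun i j _ => ⟨hp i, hp j⟩

variable [DecidableEq n] [DecidableEq m]

/-- Columns over the kernel of `Φ R` vanish by `map_mulVec_eq_zero`; rows follow by applying this to
`Aᴴ`. -/
theorem IsQuantumChannel.isSupportedOn_map {Φ : Matrix n n ℂ →ₗ[ℂ] Matrix m m ℂ}
    (hΦ : IsQuantumChannel Φ) {R : Matrix n n ℂ} (hR : R.PosDef) {V : Matrix m m ℂ} {q : m → ℝ}
    (h : IsDiagonalization (Φ R) V q) (hq : ∀ i, 0 ≤ q i) (A : Matrix n n ℂ) :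
    IsSupportedOn V q (Φ A) := by
  have hcol : ∀ X i j, q j = 0 → (Vᴴ * Φ X * V) i j = 0 := by
    intro X i j hj
    have hv : Φ R *ᵥ (V *ᵥ Pi.single j 1) = 0 := by
      rw [h.eq_diagonal, mulVec_mulVec, Matrix.mul_assoc, h.conjTranspose_mul, Matrix.mul_one,
        ← mulVec_mulVec, diagonal_mulVec_single, hj]
      simp
    have h0 := hΦ.map_mulVec_eq_zero hR hv X
    have h1 : (Vᴴ * Φ X * V) *ᵥ Pi.single j 1 = 0 := by
      rw [← mulVec_mulVec, ← mulVec_mulVec, h0, mulVec_zero]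
    simpa using congrFun h1 i
  intro i j hij
  refine ⟨(hq i).lt_of_ne' fun hi => hij ?_, (hq j).lt_of_ne' fun hj => hij (hcol A i j hj)⟩
  have h1 := hcol Aᴴ j i hi
  have h2 : Vᴴ * Φ Aᴴ * V = (Vᴴ * Φ A * V)ᴴ := by
    rw [hΦ.map_conjTranspose]
    simp only [Matrix.conjTranspose_mul, conjTranspose_conjTranspose, Matrix.mul_assoc]
  rw [h2, Matrix.conjTranspose_apply, star_eq_zero] at h1
  exact h1

/-- Monotonicity of `A ↦ tr (Aᴴ ρ⁻¹ A)` under a channel. -/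
theorem IsQuantumChannel.trace_mpow_neg_one_le {Φ : Matrix n n ℂ →ₗ[ℂ] Matrix m m ℂ}
    (hΦ : IsQuantumChannel Φ) {R : Matrix n n ℂ} (hR : R.PosDef) (A : Matrix n n ℂ) :
    ((Φ A)ᴴ * mpow (Φ R) (-1) * Φ A).trace.re ≤ (Aᴴ * mpow R (-1) * A).trace.re := by
  have hS := hΦ.posSemidef_map hR.posSemidef
  have h := hR.isHermitian.isDiagonalization
  have h' := hS.isHermitian.isDiagonalization
  have hx := h.mul_mpow_neg_one_mul (isSupportedOn_of_pos hR.eigenvalues_pos A)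
  have hy := h'.mul_mpow_neg_one_mul (hΦ.isSupportedOn_map hR h' hS.eigenvalues_nonneg A)
  have hmain := hΦ.resolvent_remainder hR.posSemidef (lam := 1) (mu := 0) zero_le_one le_rfl
    (by simpa using hx) (by simpa using hy)
  have hz := (hR.posSemidef.conjTranspose_mul_mul_same
    (mpow R (-1) * A - hsAdjoint Φ (mpow (Φ R) (-1) * Φ A))).trace_re_nonneg
  rw [Matrix.mul_assoc] at hz
  simp only [Matrix.mul_assoc] at hmain hz ⊢
  linarith

/-- A contraction paired with `R z Rᴴ`, where `tr Rᴴ R = 1`. -/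
theorem norm_trace_contraction_le {W R : Matrix n n ℂ} (hW : (1 - Wᴴ * W).PosSemidef)
    (hR : (Rᴴ * R).trace = 1) (z : Matrix n n ℂ) :
    ‖((W * R)ᴴ * (R * z)).trace‖ ≤ √((zᴴ * (Rᴴ * R * z)).trace.re) := by
  -- Cauchy–Schwarz; the factor `W R` has Hilbert–Schmidt norm at most that of `R`, which is `1`.
  refine Real.le_sqrt_of_sq_le ((norm_trace_conjTranspose_mul_le _ _).trans ?_)
  have e : (R * z)ᴴ * (R * z) = zᴴ * (Rᴴ * R * z) := by
    simp only [conjTranspose_mul, Matrix.mul_assoc]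
  have h0 := ((posSemidef_conjTranspose_mul_self (R * z)).trace_re_nonneg)
  have h1 : ((W * R)ᴴ * (W * R)).trace.re ≤ 1 := by
    have := (hW.conjTranspose_mul_mul_same R).trace_re_nonneg
    rw [Matrix.mul_sub, Matrix.sub_mul, Matrix.mul_one, trace_sub, hR, Complex.sub_re,
      Complex.one_re] at this
    have e' : (W * R)ᴴ * (W * R) = Rᴴ * (Wᴴ * W) * R := by
      simp only [conjTranspose_mul, Matrix.mul_assoc]
    rw [e']
    linarith
  rw [← e]
  exact mul_le_of_le_one_left h0 h1

theorem rotatedPetz_sub_eq {ρ : Matrix n n ℂ} (hρ : ρ.PosDef)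
    (Φ : Matrix n n ℂ →ₗ[ℂ] Matrix m m ℂ) (t : ℝ) (A : Matrix n n ℂ) :
    A - rotatedPetz ρ Φ t (Φ A) = mpow ρ (1 / 2 - t * Complex.I) *
      (mpow ρ (-(1 / 2) + t * Complex.I) * A * mpow ρ (-(1 / 2) - t * Complex.I) -
        hsAdjoint Φ (mpow (Φ ρ) (-(1 / 2) + t * Complex.I) * Φ A *
          mpow (Φ ρ) (-(1 / 2) - t * Complex.I))) * mpow ρ (1 / 2 + t * Complex.I) := by
  have h := hρ.isHermitian.isDiagonalization
  rw [Matrix.mul_sub, Matrix.sub_mul, rotatedPetz]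
  congr 1
  calc A = mpow ρ 0 * A * mpow ρ 0 := by
        rw [h.mpow_zero hρ.eigenvalues_pos, Matrix.one_mul, Matrix.mul_one]
    _ = mpow ρ (1 / 2 - t * Complex.I) * mpow ρ (-(1 / 2) + t * Complex.I) * A *
        (mpow ρ (-(1 / 2) - t * Complex.I) * mpow ρ (1 / 2 + t * Complex.I)) := by
        rw [h.mpow_mul_mpow, h.mpow_mul_mpow]
        congr 2
        · congr 2; ring
        · ring
    _ = _ := by simp only [Matrix.mul_assoc]

/-- The recovery error of the rotated Petz map is bounded by a power of the loss of the
`α`-metric. -/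
theorem traceNorm_sub_rotatedPetz_le {Φ : Matrix n n ℂ →ₗ[ℂ] Matrix m m ℂ}
    (hΦ : IsQuantumChannel Φ) {ρ : Matrix n n ℂ} (hρ : IsFaithfulState ρ) (A : Matrix n n ℂ)
    (t : ℝ) {α : ℝ} (h0 : 0 < α) (h1 : α < 1 / 2) {δ : ℝ} (hδ : 0 < δ)
    (hle : gammaAlpha α ρ A - gammaAlpha α (Φ ρ) (Φ A) ≤ δ) :
    Real.pi / Real.cosh (Real.pi * t) * traceNorm (A - rotatedPetz ρ Φ t (Φ A)) ≤
      recoveryConst α ρ Φ A * δ ^ (α / 2) := by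
  have hR := hρ.posDef
  have hS := hΦ.posSemidef_map hR.posSemidef
  have h := hR.isHermitian.isDiagonalization
  have h' := hS.isHermitian.isDiagonalization
  have hA := isSupportedOn_of_pos (U := (hR.isHermitian.eigenvectorUnitary : Matrix n n ℂ))
    hR.eigenvalues_pos A
  have hB := hΦ.isSupportedOn_map hR h' hS.eigenvalues_nonneg A
  set X := sylvester (hR.isHermitian.eigenvectorUnitary : Matrix n n ℂ)
    hR.isHermitian.eigenvalues A with hX
  set Y := sylvester (hS.isHermitian.eigenvectorUnitary : Matrix m m ℂ)
    hS.isHermitian.eigenvalues (Φ A) with hY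
  obtain ⟨W, hW, hWn⟩ := exists_traceNorm_eq (A - rotatedPetz ρ Φ t (Φ A))
  set R := mpow ρ (1 / 2 - t * Complex.I) with hRdef
  have hRt : Rᴴ = mpow ρ (1 / 2 + t * Complex.I) := by
    rw [hRdef, h.conjTranspose_mpow fun i => (hR.eigenvalues_pos i).le]
    simp
  have hRR : Rᴴ * R = ρ := by
    rw [hRt, hRdef, h.mpow_mul_mpow]
    conv_rhs => rw [← h.mpow_one]
    congr 1
    ring
  have hRtr : (Rᴴ * R).trace = 1 := by rw [hRR, hρ.trace_eq_one]
  have hlin := norm_trace_contraction_le hW hRtr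
  rw [hRR] at hlin
  -- By cyclicity `L z = tr (Wᴴ R z Rᴴ)`: the sandwich by powers of `ρ` is absorbed into the
  -- functional.
  set L : Matrix n n ℂ →ₗ[ℂ] ℂ :=
    traceLinearMap n ℂ ℂ ∘ₗ LinearMap.mulLeft ℂ ((W * R)ᴴ * R) with hL
  have hLapp : ∀ z, L z = ((W * R)ᴴ * (R * z)).trace := by
    intro z; simp [hL, Matrix.mul_assoc]
  have hLn : ∀ z, ‖L z‖ ≤ √((zᴴ * (ρ * z)).trace.re) := by
    intro z; rw [hLapp]; exact hlin z
  set s : ℂ := 1 / 2 - t * Complex.I with hs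
  have hs0 : 0 < s.re := by simp [hs]
  have hs1 : s.re < 1 := by simp [hs]; norm_num
  set g : ℝ → ℂ := fun x => L (X x) - (L ∘ₗ hsAdjoint Φ) (Y x) with hg
  have hmel := hasMellin_sub (h.hasMellin_sylvester hA L hs0 hs1).1
    (h'.hasMellin_sylvester hB (L ∘ₗ hsAdjoint Φ) hs0 hs1).1
  rw [(h.hasMellin_sylvester hA L hs0 hs1).2,
    (h'.hasMellin_sylvester hB (L ∘ₗ hsAdjoint Φ) hs0 hs1).2] at hmel
  -- On the critical line `Re s = 1/2` the sine becomes a hyperbolic cosine, the source of `π /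
  -- cosh(πt)`.
  have hsin : Complex.sin (Real.pi * s) = (Real.cosh (Real.pi * t) : ℝ) := by
    have : (Real.pi : ℂ) * s = Real.pi / 2 - ((Real.pi * t : ℝ) : ℂ) * Complex.I := by
      rw [hs]; push_cast; ring
    rw [this, Complex.sin_pi_div_two_sub, Complex.cos_mul_I, Complex.ofReal_cosh]
  have hval : mellin g s = ((Real.pi / Real.cosh (Real.pi * t) : ℝ) : ℂ) *
      (Wᴴ * (A - rotatedPetz ρ Φ t (Φ A))).trace := by
    have e1 : -s = -(1 / 2) + t * Complex.I := by rw [hs]; ring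
    have e2 : s - 1 = -(1 / 2) - t * Complex.I := by rw [hs]; ring
    rw [hg, hmel.2, rotatedPetz_sub_eq hR, hsin, e1, e2, ← mul_sub, LinearMap.comp_apply L,
      ← map_sub, hLapp, Complex.ofReal_div, ← hs, ← hRdef, ← hRt,
      ← Matrix.mul_assoc Wᴴ, trace_mul_comm _ Rᴴ, conjTranspose_mul, Matrix.mul_assoc Rᴴ]
  have hnorm : ∀ x ∈ Ioi (0 : ℝ), ‖(x : ℂ) ^ (s - 1) • g x‖ = x ^ (-(1 / 2) : ℝ) * ‖g x‖ := by
    intro x hx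
    rw [norm_smul, Complex.norm_cpow_eq_rpow_re_of_pos hx]
    congr 2
    simp [hs]
    norm_num
  have hG : IntegrableOn (fun x : ℝ => x ^ (-(1 / 2) : ℝ) * ‖g x‖) (Ioi 0) :=
    IntegrableOn.congr_fun (Integrable.norm hmel.1) hnorm measurableSet_Ioi
  have hbound : Real.pi / Real.cosh (Real.pi * t) * traceNorm (A - rotatedPetz ρ Φ t (Φ A)) ≤
      ∫ x in Ioi 0, x ^ (-(1 / 2) : ℝ) * ‖g x‖ := by
    have hc : 0 ≤ Real.pi / Real.cosh (Real.pi * t) :=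
      div_nonneg Real.pi_pos.le (Real.cosh_pos _).le
    calc _ ≤ ‖mellin g s‖ := by
          rw [hval, norm_mul, Complex.norm_of_nonneg hc, hWn]
          exact mul_le_mul_of_nonneg_left (Complex.re_le_norm _) hc
      _ ≤ ∫ x in Ioi (0 : ℝ), ‖(x : ℂ) ^ (s - 1) • g x‖ := norm_integral_le_integral_norm _
      _ = _ := setIntegral_congr_fun measurableSet_Ioi hnorm
  refine hbound.trans ?_
  obtain ⟨hi, hv⟩ := h.integral_trace_sylvester hA h0 (by linarith : α < 1)
  obtain ⟨hi', hv'⟩ := h'.integral_trace_sylvester hB h0 (by linarith : α < 1)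
  have hα : 0 < Real.sin (Real.pi * α) :=
    Real.sin_pos_of_pos_of_lt_pi (mul_pos Real.pi_pos h0) (by nlinarith [Real.pi_pos])
  have hX1 : ∀ x, 0 < x → ‖L (X x)‖ ≤ √((mpow ρ (-2) * Aᴴ * ρ * A).trace.re) := fun x hx =>
    (hLn _).trans (Real.sqrt_le_sqrt (h.trace_sylvester_le hA hx).1)
  have hX2 : ∀ x, 0 < x → ‖L (X x)‖ ≤ √((Aᴴ * mpow ρ (-1) * A).trace.re) / x := fun x hx => by
    refine (hLn _).trans ((Real.sqrt_le_sqrt (h.trace_sylvester_le hA hx).2).trans_eq ?_)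
    rw [Real.sqrt_div' _ (sq_nonneg x), Real.sqrt_sq hx.le]
  have hY0 : ∀ x, ‖L (hsAdjoint Φ (Y x))‖ ≤ √(((Y x)ᴴ * (Φ ρ * Y x)).trace.re) := fun x =>
    (hLn _).trans (Real.sqrt_le_sqrt (hΦ.trace_hsAdjoint_left_le hR.posSemidef _))
  have hY1 : ∀ x, 0 < x → ‖L (hsAdjoint Φ (Y x))‖ ≤
      √((mpow (Φ ρ) (-2) * (Φ A)ᴴ * Φ ρ * Φ A).trace.re) := fun x hx =>
    (hY0 x).trans (Real.sqrt_le_sqrt (h'.trace_sylvester_le hB hx).1)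
  have hY2 : ∀ x, 0 < x → ‖L (hsAdjoint Φ (Y x))‖ ≤
      √((Aᴴ * mpow ρ (-1) * A).trace.re) / x := fun x hx => by
    refine (hY0 x).trans ((Real.sqrt_le_sqrt (h'.trace_sylvester_le hB hx).2).trans ?_)
    rw [Real.sqrt_div' _ (sq_nonneg x), Real.sqrt_sq hx.le]
    exact div_le_div_of_nonneg_right (Real.sqrt_le_sqrt (hΦ.trace_mpow_neg_one_le hR A)) hx.le
  -- `X` and `Φ†Y` each contribute `√(tr Aᴴ ρ⁻¹ A) / x`, the latter through monotonicity; hence `b`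
  -- has a factor `2` and the constant a `4`.
  refine (integral_le_mul_rpow_of_mul_sq_le (G := fun x => ‖g x‖)
    (d := fun x => (Aᴴ * X x).trace.re - ((Φ A)ᴴ * Y x).trace.re)
    (b := 2 * √((Aᴴ * mpow ρ (-1) * A).trace.re))
    (c := √((mpow ρ (-2) * Aᴴ * ρ * A).trace.re) +
      √((mpow (Φ ρ) (-2) * (Φ A)ᴴ * Φ ρ * Φ A).trace.re))
    h0 h1 (by positivity) (by positivity) hδ hG ?_ ?_ ?_ ?_ ?_).trans_eq ?_
  · simp only [mul_sub]
    exact hi.sub hi'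
  · simp only [mul_sub]
    rw [integral_sub hi hi', hv, hv', ← mul_sub]
    exact mul_le_mul_of_nonneg_left hle (div_nonneg Real.pi_pos.le hα.le)
  · intro x hx
    have hmain := hΦ.resolvent_remainder hR.posSemidef hx.le zero_le_one
      (h.sylvester_spec hA hx) (h'.sylvester_spec hB hx)
    refine le_trans (mul_le_mul_of_nonneg_left ?_ hx.le) hmain
    have : g x = L (X x - hsAdjoint Φ (Y x)) := by simp [hg]
    rw [this]
    have hz := (hR.posSemidef.conjTranspose_mul_mul_same
      (X x - hsAdjoint Φ (Y x))).trace_re_nonneg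
    rw [Matrix.mul_assoc] at hz
    calc _ ≤ (√(((X x - hsAdjoint Φ (Y x))ᴴ * (ρ * (X x - hsAdjoint Φ (Y x)))).trace.re)) ^ 2 :=
          pow_le_pow_left₀ (norm_nonneg _) (hLn _) 2
      _ = _ := Real.sq_sqrt hz
  · intro x hx
    exact (norm_sub_le _ _).trans (add_le_add (hX1 x hx) (hY1 x hx))
  · intro x hx
    refine (norm_sub_le _ _).trans ((add_le_add (hX2 x hx) (hY2 x hx)).trans_eq ?_)
    ring
  · rw [recoveryConst]
    ring

/-- The `α`-metric is monotone under channels. -/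
theorem gammaAlpha_map_le {Φ : Matrix n n ℂ →ₗ[ℂ] Matrix m m ℂ}
    (hΦ : IsQuantumChannel Φ) {ρ : Matrix n n ℂ} (hR : ρ.PosDef) (A : Matrix n n ℂ)
    {α : ℝ} (h0 : 0 < α) (h1 : α < 1) :
    gammaAlpha α (Φ ρ) (Φ A) ≤ gammaAlpha α ρ A := by
  have hS := hΦ.posSemidef_map hR.posSemidef
  have h := hR.isHermitian.isDiagonalization
  have h' := hS.isHermitian.isDiagonalization
  have hA := isSupportedOn_of_pos (U := (hR.isHermitian.eigenvectorUnitary : Matrix n n ℂ))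
    hR.eigenvalues_pos A
  have hB := hΦ.isSupportedOn_map hR h' hS.eigenvalues_nonneg A
  obtain ⟨hi, hv⟩ := h.integral_trace_sylvester hA h0 h1
  obtain ⟨hi', hv'⟩ := h'.integral_trace_sylvester hB h0 h1
  have hα : 0 < Real.sin (Real.pi * α) :=
    Real.sin_pos_of_pos_of_lt_pi (mul_pos Real.pi_pos h0) (by nlinarith [Real.pi_pos])
  refine le_of_mul_le_mul_left (a := Real.pi / Real.sin (Real.pi * α)) ?_
    (div_pos Real.pi_pos hα)
  rw [← hv, ← hv']
  refine setIntegral_mono_on hi' hi measurableSet_Ioi fun x hx => ?_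
  have hx : 0 < x := hx
  refine mul_le_mul_of_nonneg_left ?_ (Real.rpow_nonneg hx.le _)
  have hmain := hΦ.resolvent_remainder hR.posSemidef hx.le zero_le_one
    (h.sylvester_spec hA hx) (h'.sylvester_spec hB hx)
  have hz := (hR.posSemidef.conjTranspose_mul_mul_same
    (sylvester (hR.isHermitian.eigenvectorUnitary : Matrix n n ℂ) hR.isHermitian.eigenvalues A x -
      hsAdjoint Φ (sylvester (hS.isHermitian.eigenvectorUnitary : Matrix m m ℂ)
        hS.isHermitian.eigenvalues (Φ A) x))).trace_re_nonneg
  rw [Matrix.mul_assoc] at hz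
  have := mul_nonneg hx.le hz
  linarith

theorem recoveryConst_pos {α : ℝ} (h0 : 0 < α) (h1 : α < 1) (ρ : Matrix n n ℂ)
    (Φ : Matrix n n ℂ →ₗ[ℂ] Matrix m m ℂ) (A : Matrix n n ℂ) : 0 < recoveryConst α ρ Φ A := by
  have hα : 0 < Real.sin (Real.pi * α) :=
    Real.sin_pos_of_pos_of_lt_pi (mul_pos Real.pi_pos h0) (by nlinarith [Real.pi_pos])
  have : 0 < √(Real.pi / (α * Real.sin (Real.pi * α))) :=
    Real.sqrt_pos.2 (div_pos Real.pi_pos (mul_pos h0 hα))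
  rw [recoveryConst]
  positivity

end Recovery

end AlphaMetric

end

/-! ### Conclusion by a limit in the loss. -/

theorem corollary4p10 {n m : Type*} [Fintype n] [DecidableEq n] [Fintype m] [DecidableEq m]
    (Φ : Matrix n n ℂ →ₗ[ℂ] Matrix m m ℂ) (hΦ : AlphaMetric.IsQuantumChannel Φ)
    (ρ : Matrix n n ℂ) (hρ : AlphaMetric.IsFaithfulState ρ)
    (A : Matrix n n ℂ) (t α : ℝ) (hα : α ∈ Set.Ioo (0 : ℝ) (1 / 2)) :
    AlphaMetric.gammaAlpha α ρ A - AlphaMetric.gammaAlpha α (Φ ρ) (Φ A) ≥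
      (Real.pi / Real.cosh (Real.pi * t) *
          (AlphaMetric.traceNorm (A - AlphaMetric.rotatedPetz ρ Φ t (Φ A)) /
            AlphaMetric.recoveryConst α ρ Φ A)) ^ (2 / α) := by
  obtain ⟨h0, h1⟩ := hα
  set δ := AlphaMetric.gammaAlpha α ρ A - AlphaMetric.gammaAlpha α (Φ ρ) (Φ A) with hδ
  set T := Real.pi / Real.cosh (Real.pi * t) *
    AlphaMetric.traceNorm (A - AlphaMetric.rotatedPetz ρ Φ t (Φ A)) with hT
  set K := AlphaMetric.recoveryConst α ρ Φ A
  have hK : 0 < K := AlphaMetric.recoveryConst_pos h0 (by linarith) ρ Φ A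
  have hδ0 : 0 ≤ δ := sub_nonneg.2 (AlphaMetric.gammaAlpha_map_le hΦ hρ.posDef A h0 (by linarith))
  have hT0 : 0 ≤ T := by
    refine mul_nonneg (div_nonneg Real.pi_pos.le (Real.cosh_pos _).le) ?_
    exact AlphaMetric.traceNorm_nonneg _
  -- The recovery bound needs a strictly positive parameter, while the loss `δ` may vanish; it is
  -- applied to every `e > δ`, and `e` tends to `δ`.
  have hle : T ≤ K * δ ^ (α / 2) := by
    have hcont : Filter.Tendsto (fun e : ℝ => K * e ^ (α / 2)) (nhdsWithin δ (Set.Ioi δ))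
        (nhds (K * δ ^ (α / 2))) :=
      (((Real.continuous_rpow_const (by positivity)).tendsto δ).mono_left
        nhdsWithin_le_nhds).const_mul K
    refine ge_of_tendsto hcont ?_
    filter_upwards [self_mem_nhdsWithin] with e he
    exact AlphaMetric.traceNorm_sub_rotatedPetz_le hΦ hρ A t h0 h1 (hδ0.trans_lt he)
      (le_of_lt he)
  have hdiv : T / K ≤ δ ^ (α / 2) := by rwa [div_le_iff₀ hK, mul_comm]
  rw [← mul_div_assoc, ← hT, ge_iff_le]
  calc (T / K) ^ (2 / α) ≤ (δ ^ (α / 2)) ^ (2 / α) :=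
        Real.rpow_le_rpow (by positivity) hdiv (by positivity)
    _ = δ := by
        rw [← Real.rpow_mul hδ0]
        have : α / 2 * (2 / α) = 1 := by field_simp
        rw [this, Real.rpow_one]
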